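/- Let $su(N)$ be the real Lie algebra of traceless skew-Hermitian complex $N\times N$ matrices. A Cartan decomposition $su(N)=\mathfrak t\oplus\mathfrak p$ is a direct sum of a Lie subalgebra $\mathfrak t$ and a real vector subspace $\mathfrak p$ with $[\mathfrak t,\mathfrak t]\subset\mathfrak t$, $[\mathfrak t,\mathfrak p]\subset\mathfrak p$, $[\mathfrak p,\mathfrak p]\subset\mathfrak t$ and $\mathrm{Tr}(\mathfrak t\,\mathfrak p)=0$. Write $^*$ for entrywise complex conjugation and $^\dagger$ for the conjugate transpose. The decomposition is said to be of type AI, AII or AIII if there is a unitary $U$ such that $(U\mathfrak tU^{\dagger},U\mathfrak pU^{\dagger})$ is, respectively, the following intrinsic pair. * AI: $\hat{\mathfrak t}=so(N)$, the real antisymmetric matrices, and $\hat{\mathfrak p}=\{iA: A \text{ real symmetric},\ \mathrm{Tr}A=0\}$. * AII ($N=2n$): $\hat{\mathfrak t}=sp(n)=su(2n)\cap sp(2n,\mathbb C)$ and $\hat{\mathfrak p}=\left\{\begin{pmatrix}Z_1&Z_2\\Z_2^*&-Z_1^*\end{pmatrix}: Z_1\in su(n),\ Z_2\in so(n,\mathbb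 C)\right\}$. * AIII ($N=m+n$): $\hat{\mathfrak t}=s(u(m)\oplus u(n))$, the block diagonal matrices in $su(m+n)$, and $\hat{\mathfrak p}=\left\{\begin{pmatrix}0&Z\\-Z^\dagger&0\end{pmatrix}: Z\in M_{m\times n}(\mathbb C)\right\}$. For $\zeta,\alpha\in\mathbb Z_2^p$ let $\mathcal S^\zeta_\alpha=\sum_{\beta\in\mathbb Z_2^p}(-1)^{\zeta\cdot\beta}|\beta\rangle\langle\beta+\alpha|$ be the spinors, matrices of size $2^p$. A set of spinors is identified with its set of labels $(\zeta,\alpha)$, and its span in $su(2^p)$ is the real subspace of those elements of $su(2^p)$ that are complex linear combinations of its members. A bi-subalgebra is a nonempty set of spinors that contains $\mathcal S^{\zeta+\eta}_{\alpha+\beta}$ whenever it contains $\mathcal S^\zeta_\alpha$ and $\mathcal S^\eta_\beta$. A bi-subalgebra is called a Cartan subalgebra if its span in $su(2^p)$ is one. A proper maximal bi-subalgebra of such a $\mathfrak C$ is a bi-subalgebra $\mathfrak B\subsetneq\mathfrak C$ with $\mathcal S^{\zeta+\eta}_{\alpha+\beta}\in\mathfrak B$ for all $\mathcal S^\zeta_\alpha,\mathcal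 S^\eta_\beta\in\mathfrak C-\mathfrak B$. Theorem. 1. Let $su(N)=\mathfrak t\oplus\mathfrak p$ be a Cartan decomposition. If $\mathfrak p$ contains a Cartan subalgebra of $su(N)$, then the decomposition is of type AI. 2. Let $su(2^p)=\mathfrak t\oplus\mathfrak p$ be a Cartan decomposition, and let $\mathfrak B$ be a proper maximal bi-subalgebra of a Cartan subalgebra $\mathfrak C\subset su(2^p)$ formed by spinors. If the span of $\mathfrak B$ in $su(2^p)$ is a maximal abelian subalgebra in $\mathfrak p$, then the decomposition is of type AII, with $n=2^{p-1}$. 3. In the situation of 2, if instead the span of the complement $\mathfrak B^c=\mathfrak C-\mathfrak B$ is a maximal abelian subalgebra in $\mathfrak p$, then the decomposition is of type AIII, with $m=n=2^{p-1}$. -/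

import Mathlib

open Matrix

attribute [local instance 100] LieRing.ofAssociativeRing

/-- The compact real Lie algebra `su(N)`: traceless skew-Hermitian complex matrices whose rows and
columns are indexed by the finite type `ι`, as a real Lie subalgebra of all matrices. -/
def su (ι : Type) [Fintype ι] [DecidableEq ι] : LieSubalgebra ℝ (Matrix ι ι ℂ) where
  carrier := {X | Xᴴ = -X ∧ X.trace = 0}
  zero_mem' := by simp
  add_mem' := by
    rintro X Y ⟨hX, hX'⟩ ⟨hY, hY'⟩
    refine ⟨?_, ?_⟩
    · rw [conjTranspose_add, hX, hY]; abel
    · rw [trace_add, hX', hY', add_zero]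
  smul_mem' := by
    rintro c X ⟨hX, hX'⟩
    refine ⟨?_, ?_⟩
    · rw [conjTranspose_smul, hX, star_trivial, smul_neg]
    · rw [trace_smul, hX', smul_zero]
  lie_mem' := by
    rintro X Y ⟨hX, _⟩ ⟨hY, _⟩
    refine ⟨?_, ?_⟩
    · rw [Ring.lie_def, conjTranspose_sub, conjTranspose_mul, conjTranspose_mul, hX, hY]
      noncomm_ring
    · rw [Ring.lie_def, trace_sub, trace_mul_comm, sub_self]

/-! ### Cartan decompositions and abelian subalgebras -/

/-- `su(N) = t ⊕ 𝔭` is a Cartan decomposition: `[t,t] ⊆ t` (since `t` is a subalgebra),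
`[t,𝔭] ⊆ 𝔭`, `[𝔭,𝔭] ⊆ t` and `Tr(t𝔭) = 0`. -/
structure IsCartanDecomposition {ι : Type} [Fintype ι] [DecidableEq ι]
    (t : LieSubalgebra ℝ (su ι)) (𝔭 : Submodule ℝ (su ι)) : Prop where
  isCompl : IsCompl t.toSubmodule 𝔭
  lie_t_p : ∀ X ∈ t, ∀ Y ∈ 𝔭, ⁅X, Y⁆ ∈ 𝔭
  lie_p_p : ∀ X ∈ 𝔭, ∀ Y ∈ 𝔭, ⁅X, Y⁆ ∈ t
  trace_mul : ∀ X ∈ t, ∀ Y ∈ 𝔭, ((X : Matrix ι ι ℂ) * (Y : Matrix ι ι ℂ)).trace = 0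

/-- `𝔞` is a maximal abelian subalgebra in the real vector subspace `𝔭` of `su(N)`.
(A subspace on which the bracket vanishes is a subalgebra.) -/
def IsMaximalAbelianIn {ι : Type} [Fintype ι] [DecidableEq ι]
    (𝔞 𝔭 : Submodule ℝ (su ι)) : Prop :=
  Maximal (fun 𝔟 : Submodule ℝ (su ι) => 𝔟 ≤ 𝔭 ∧ ∀ X ∈ 𝔟, ∀ Y ∈ 𝔟, ⁅X, Y⁆ = 0) 𝔞

/-! ### The intrinsic decompositions and the three types -/

/-- The pair `(t, 𝔭)` of subspaces of `su(N)` is carried to the pair `(t', 𝔭')` of sets of matrices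
by the conjugation `X ↦ U X U†` with some unitary `U : ℂ^ι → ℂ^κ`. -/
def IsUnitarilyConjugate {ι κ : Type} [Fintype ι] [DecidableEq ι] [Fintype κ] [DecidableEq κ]
    (t : LieSubalgebra ℝ (su ι)) (𝔭 : Submodule ℝ (su ι)) (t' 𝔭' : Set (Matrix κ κ ℂ)) : Prop :=
  ∃ U : Matrix κ ι ℂ, Uᴴ * U = 1 ∧ U * Uᴴ = 1 ∧
    (fun X : su ι => U * (X : Matrix ι ι ℂ) * Uᴴ) '' (t : Set (su ι)) = t' ∧
    (fun X : su ι => U * (X : Matrix ι ι ℂ) * Uᴴ) '' (𝔭 : Set (su ι)) = 𝔭'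

/-- `so(N)`: real antisymmetric matrices. -/
def intrinsicTI (ι : Type) [Fintype ι] [DecidableEq ι] : Set (Matrix ι ι ℂ) :=
  {X | ∃ A ∈ LieAlgebra.Orthogonal.so ι ℝ, X = A.map Complex.ofReal}

/-- `i` times the real symmetric traceless matrices. -/
def intrinsicPI (ι : Type) [Fintype ι] [DecidableEq ι] : Set (Matrix ι ι ℂ) :=
  {X | ∃ A : Matrix ι ι ℝ, A.IsSymm ∧ A.trace = 0 ∧ X = Complex.I • A.map Complex.ofReal}

/-- The compact symplectic algebra `sp(n) = su(2n) ∩ sp(2n, ℂ)`. -/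
def intrinsicTII (n : ℕ) : Set (Matrix (Fin n ⊕ Fin n) (Fin n ⊕ Fin n) ℂ) :=
  {X | X ∈ su (Fin n ⊕ Fin n) ∧ X ∈ LieAlgebra.Symplectic.sp (Fin n) ℂ}

/-- The matrices `(Z₁, Z₂; Z₂*, -Z₁*)` with `Z₁ ∈ su(n)`, `Z₂ ∈ so(n, ℂ)`, where `*` is entrywise
complex conjugation. -/
def intrinsicPII (n : ℕ) : Set (Matrix (Fin n ⊕ Fin n) (Fin n ⊕ Fin n) ℂ) :=
  {X | ∃ Z₁ ∈ su (Fin n), ∃ Z₂ ∈ LieAlgebra.Orthogonal.so (Fin n) ℂ,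
    X = fromBlocks Z₁ Z₂ (Z₂.map star) (-(Z₁.map star))}

/-- `s(u(m) ⊕ u(n)) = c ⊕ su(m) ⊕ su(n)`: the block diagonal matrices in `su(m + n)`. -/
def intrinsicTIII (m n : ℕ) : Set (Matrix (Fin m ⊕ Fin n) (Fin m ⊕ Fin n) ℂ) :=
  {X | X ∈ su (Fin m ⊕ Fin n) ∧
    ∃ (A : Matrix (Fin m) (Fin m) ℂ) (D : Matrix (Fin n) (Fin n) ℂ), X = fromBlocks A 0 0 D}

/-- The matrices `(0, Z; -Z†, 0)` with `Z` an arbitrary complex `m × n` matrix. -/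
def intrinsicPIII (m n : ℕ) : Set (Matrix (Fin m ⊕ Fin n) (Fin m ⊕ Fin n) ℂ) :=
  {X | ∃ Z : Matrix (Fin m) (Fin n) ℂ, X = fromBlocks 0 Z (-Zᴴ) 0}

/-- `t ⊕ 𝔭` is of type AI. -/
def IsTypeAI {ι : Type} [Fintype ι] [DecidableEq ι]
    (t : LieSubalgebra ℝ (su ι)) (𝔭 : Submodule ℝ (su ι)) : Prop :=
  IsUnitarilyConjugate t 𝔭 (intrinsicTI ι) (intrinsicPI ι)

/-- `t ⊕ 𝔭` is of type AII, with `t` conjugate to `sp(n)` (so `N = 2n`). -/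
def IsTypeAII {ι : Type} [Fintype ι] [DecidableEq ι]
    (t : LieSubalgebra ℝ (su ι)) (𝔭 : Submodule ℝ (su ι)) (n : ℕ) : Prop :=
  IsUnitarilyConjugate t 𝔭 (intrinsicTII n) (intrinsicPII n)

/-- `t ⊕ 𝔭` is of type AIII, with `t` conjugate to `s(u(m) ⊕ u(n))` (so `N = m + n`). -/
def IsTypeAIII {ι : Type} [Fintype ι] [DecidableEq ι]
    (t : LieSubalgebra ℝ (su ι)) (𝔭 : Submodule ℝ (su ι)) (m n : ℕ) : Prop :=
  IsUnitarilyConjugate t 𝔭 (intrinsicTIII m n) (intrinsicPIII m n)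

/-! ### Spinors and bi-subalgebras of `su(2^p)` -/

/-- Bit strings of length `p`; they index the rows and columns of the matrices in `su(2^p)`. -/
abbrev Bits (p : ℕ) : Type := Fin p → ZMod 2

/-- The spinor `S^ζ_α = ∑_β (-1)^{ζ·β} |β⟩⟨β+α|`, i.e. the tensor product over the digits of
`|0⟩⟨a| + (-1)^ε |1⟩⟨1+a|`. -/
def spinor {p : ℕ} (ζ α : Bits p) : Matrix (Bits p) (Bits p) ℂ :=
  Matrix.of fun β γ => if γ = β + α then (-1 : ℂ) ^ (ζ ⬝ᵥ β).val else 0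

/-- The subspace of `su(2^p)` spanned by the spinors with labels `(ζ, α) ∈ G`: the elements of
`su(2^p)` that are combinations of these spinors. Complex coefficients absorb the phase which makes
`S^ζ_α` skew-Hermitian; the identity `S^0_0` contributes nothing, as `su(2^p)` is traceless and
every other spinor has trace zero. -/
noncomputable def spinorSubspace {p : ℕ} (G : Set (Bits p × Bits p)) : Submodule ℝ (su (Bits p)) :=
  ((Submodule.span ℂ ((fun g : Bits p × Bits p => spinor g.1 g.2) '' G)).restrictScalars ℝ).comap
    (su (Bits p)).toSubmodule.subtype

/-- A set of spinors closed under `(S^ζ_α, S^η_β) ↦ S^{ζ+η}_{α+β}` is a bi-subalgebra; it is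
recorded by its labels `(ζ, α)`, which form a subgroup. The bi-subalgebra `C` is a Cartan
subalgebra of `su(2^p)` if its spinors span one. -/
def IsSpinorCartan {p : ℕ} (C : AddSubgroup (Bits p × Bits p)) : Prop :=
  ∃ H : LieSubalgebra ℝ (su (Bits p)), H.IsCartanSubalgebra ∧
    H.toSubmodule = spinorSubspace (C : Set (Bits p × Bits p))

/-- `B` is a proper maximal bi-subalgebra of `C`: a bi-subalgebra properly contained in `C` with
`S^{ζ+η}_{α+β} ∈ B` for all `S^ζ_α, S^η_β ∈ C - B`. -/
def IsProperMaximalBiSubalgebra {p : ℕ} (B C : AddSubgroup (Bits p × Bits p)) : Prop :=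
  B < C ∧ ∀ x ∈ C, x ∉ B → ∀ y ∈ C, y ∉ B → x + y ∈ B

/-!
A Cartan decomposition `su(N) = t ⊕ 𝔭` is the same as an involutive automorphism `θ` of `su(N)`, equal
to `1` on `t` and to `-1` on `𝔭`, and in each case `θ` can be computed from its values on one Cartan
subalgebra. Such a subalgebra is unitarily conjugate to the diagonal matrices
(`exists_unitary_cartan`): it is abelian because a nilpotent skew operator vanishes. A homomorphism of
`su(N)` that permutes the entries of diagonal matrices by `σ` is the conjugation by a monomial unitary
matrix `V = D P_σ`, since it rotates the real root spaces compatibly with their brackets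
(`exists_eq_adMono`); if it also changes the sign of diagonal matrices, then a complex conjugation
follows (`exists_eq_starSu_adMono`).

If `𝔭` contains a Cartan subalgebra, then `θ = -1` on the diagonal, so `θ X = (D X D†)*`, and the
conjugation by a square root of `D` makes `θ` the complex conjugation, type AI.

For a spinor Cartan subalgebra `C` and a proper maximal bi-subalgebra `B` there is a spinor commuting
with `B` and anticommuting with `C - B`. It permutes the joint eigenlines of `C` by a
fixed-point-free involution `σ`, and in a joint eigenbasis the spans of `B` and `C - B` become the
`σ`-even and the `σ`-odd diagonal matrices (`exists_spinor_diagonalization`). If one of them is maximal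
abelian in `𝔭`, then the other one lies in `t`, as it commutes with it and is orthogonal to it
(`IsCartanDecomposition.mem_of_commute`); so `θ` is `∓P_σ` on diagonal matrices.

For `B` this gives `θ X = (V X V†)*`. The same argument puts the root vectors of the pairs `i, σ i` into
`t`, which forces `V` to be antisymmetric, and a monomial change of basis turns `V` into the standard
symplectic matrix up to sign, type AII. For `C - B` it gives `θ X = V X V†`, where `V²` is scalar because
`θ² = 1`; so `V` becomes a multiple of the exchange of two summands `ℂ^n`, which the Hadamard matrix
diagonalises as `diag(1, -1)`, type AIII.
-/

/-! ### Diagonalisation of Cartan subalgebras -/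

open scoped ComplexOrder in
/-- For skew-Hermitian `X` the map `ad X` is skew for the form `Tr(A†B)`, so that `(ad X)²` has the
same kernel as `ad X`. -/
theorem lie_eq_zero_of_lie_lie_eq_zero {ι : Type} [Fintype ι] [DecidableEq ι]
    {X Y : Matrix ι ι ℂ} (hX : Xᴴ = -X) (h : ⁅X, ⁅X, Y⁆⁆ = 0) : ⁅X, Y⁆ = 0 := by
  rw [← trace_conjTranspose_mul_self_eq_zero_iff]
  have h1 : (⁅X, Y⁆ᴴ * ⁅X, Y⁆).trace = -(Yᴴ * ⁅X, ⁅X, Y⁆⁆).trace := by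
    generalize hZ : ⁅X, Y⁆ = Z
    have : Zᴴ = X * Yᴴ - Yᴴ * X := by
      rw [← hZ, Ring.lie_def, conjTranspose_sub, conjTranspose_mul, conjTranspose_mul, hX]
      noncomm_ring
    rw [this, Ring.lie_def, sub_mul, mul_sub, trace_sub, trace_sub, ← mul_assoc, ← mul_assoc,
      Matrix.mul_assoc X, trace_mul_comm X]
    ring
  rw [h1, h, mul_zero, trace_zero, neg_zero]

/-- A nilpotent subalgebra of `su(N)` is abelian: the restriction of `ad X` to it is both nilpotent and
skew. -/
theorem commute_of_isNilpotent {ι : Type} [Fintype ι] [DecidableEq ι]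
    (H : LieSubalgebra ℝ (su ι)) [LieRing.IsNilpotent H] {X Y : su ι} (hX : X ∈ H) (hY : Y ∈ H) :
    ⁅X, Y⁆ = 0 := by
  obtain ⟨k, hk⟩ := LieModule.isNilpotent_toEnd_of_isNilpotent ℝ H H ⟨X, hX⟩
  set T := LieModule.toEnd ℝ H H ⟨X, hX⟩
  have step : ∀ Z : H, T (T Z) = 0 → T Z = 0 := by
    intro Z hZ
    have h1 : ⁅(X : Matrix ι ι ℂ), ⁅(X : Matrix ι ι ℂ), ((Z : su ι) : Matrix ι ι ℂ)⁆⁆ = 0 :=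
      congrArg (fun W : H => ((W : su ι) : Matrix ι ι ℂ)) hZ
    have h2 := lie_eq_zero_of_lie_lie_eq_zero X.2.1 h1
    exact Subtype.ext (Subtype.ext h2)
  have key : ∀ n : ℕ, ∀ Z : H, (T ^ (n + 1)) Z = 0 → T Z = 0 := by
    intro n
    induction n with
    | zero => intro Z hZ; simpa using hZ
    | succ n ih =>
      intro Z hZ
      rw [pow_succ, Module.End.mul_apply] at hZ
      exact step Z (ih _ hZ)
  have h3 : T ⟨Y, hY⟩ = 0 := key k _ (by rw [pow_succ', hk]; simp)
  exact congrArg (fun W : H => (W : su ι)) h3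

/-- Pairwise commuting Hermitian matrices are diagonalised by a common unitary matrix. -/
theorem exists_unitary_isDiag {ι α : Type} [Fintype ι] [DecidableEq ι]
    (A : α → Matrix ι ι ℂ) (hA : ∀ a, (A a).IsHermitian) (hc : ∀ a b, Commute (A a) (A b)) :
    ∃ U : Matrix ι ι ℂ, Uᴴ * U = 1 ∧ U * Uᴴ = 1 ∧ ∀ a, (U * A a * Uᴴ).IsDiag := by
  classical
  let T : α → Module.End ℂ (EuclideanSpace ℂ ι) := fun a => toEuclideanLin (A a)
  have hT : ∀ a, (T a).IsSymmetric := fun a => isSymmetric_toEuclideanLin_iff.2 (hA a)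
  have hC : Pairwise (Function.onFun Commute T) := by
    intro a b _
    ext v : 1
    simp only [T, Module.End.mul_apply, toLpLin_apply, mulVec_mulVec, (hc a b).eq]
  have hint := LinearMap.IsSymmetric.directSum_isInternal_of_pairwise_commute hT hC
  have hfam := LinearMap.IsSymmetric.orthogonalFamily_iInf_eigenspaces hT
  let v := fun γ : α → ℂ =>
    stdOrthonormalBasis ℂ (⨅ j, Module.End.eigenspace (T j) (γ j) : Submodule ℂ (EuclideanSpace ℂ ι))
  let b := hint.collectedBasis (fun γ => (v γ).toBasis)
  have hb : Orthonormal ℂ b := hint.collectedBasis_orthonormal hfam (fun γ => by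
    rw [OrthonormalBasis.coe_toBasis]; exact (v γ).orthonormal)
  have : Fintype (Σ γ : α → ℂ, Fin (Module.finrank ℂ
      (⨅ j, Module.End.eigenspace (T j) (γ j) : Submodule ℂ (EuclideanSpace ℂ ι)))) :=
    FiniteDimensional.fintypeBasisIndex b
  have hcard := Module.finrank_eq_card_basis b
  rw [finrank_euclideanSpace] at hcard
  let e := Fintype.equivOfCardEq hcard
  let c : ι → EuclideanSpace ℂ ι := fun i => b (e i)
  have hon : Orthonormal ℂ c := hb.comp _ e.injective
  have heig : ∀ a i, ∃ μ : ℂ, T a (c i) = μ • c i := by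
    intro a i
    have hm : c i ∈ (⨅ j, Module.End.eigenspace (T j) ((e i).1 j)) :=
      hint.collectedBasis_mem (fun γ => (v γ).toBasis) (e i)
    exact ⟨_, Module.End.mem_eigenspace_iff.1 ((Submodule.mem_iInf _).1 hm a)⟩
  let U : Matrix ι ι ℂ := Matrix.of fun i j => star (c i j)
  have hUM : ∀ (M : Matrix ι ι ℂ) i j,
      (U * M * Uᴴ) i j = inner ℂ (c i) (toEuclideanLin M (c j)) := by
    intro M i j
    rw [EuclideanSpace.inner_eq_star_dotProduct, Matrix.mul_assoc]
    simp only [Matrix.mul_apply, dotProduct, toLpLin_apply, mulVec, U, conjTranspose_apply,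
      of_apply, star_star, Pi.star_apply]
    exact Finset.sum_congr rfl fun _ _ => mul_comm _ _
  have h1 : U * Uᴴ = 1 := by
    ext i j
    have := hUM 1 i j
    rw [Matrix.mul_one] at this
    rw [this, one_apply, toLpLin_one, LinearMap.id_apply]
    exact orthonormal_iff_ite.1 hon i j
  refine ⟨U, mul_eq_one_comm.1 h1, h1, fun a i j hij => ?_⟩
  obtain ⟨μ, hμ⟩ := heig a j
  rw [hUM]
  change inner ℂ (c i) (T a (c j)) = 0
  rw [hμ, inner_smul_right, hon.2 hij, mul_zero]

theorem isDiag_mul_comm {ι : Type} [Fintype ι] [DecidableEq ι] {X Y : Matrix ι ι ℂ}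
    (hX : X.IsDiag) (hY : Y.IsDiag) : X * Y = Y * X := by
  rw [← hX.diagonal_diag, ← hY.diagonal_diag, diagonal_mul_diagonal, diagonal_mul_diagonal]
  congr 1; ext i; exact mul_comm _ _

/-- Every Cartan subalgebra of `su(N)` is unitarily conjugate to the diagonal one. -/
theorem exists_unitary_cartan {ι : Type} [Fintype ι] [DecidableEq ι]
    (H : LieSubalgebra ℝ (su ι)) (hH : H.IsCartanSubalgebra) :
    ∃ U : Matrix ι ι ℂ, Uᴴ * U = 1 ∧ U * Uᴴ = 1 ∧
      ∀ X : su ι, X ∈ H ↔ (U * (X : Matrix ι ι ℂ) * Uᴴ).IsDiag := by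
  have hab : ∀ X Y : H, Commute ((X : su ι) : Matrix ι ι ℂ) ((Y : su ι) : Matrix ι ι ℂ) := by
    intro X Y
    have := congrArg (fun W : su ι => (W : Matrix ι ι ℂ)) (commute_of_isNilpotent H X.2 Y.2)
    exact sub_eq_zero.1 this
  obtain ⟨U, hU, hU', hd⟩ := exists_unitary_isDiag
    (fun X : H => Complex.I • ((X : su ι) : Matrix ι ι ℂ))
    (fun X => by
      rw [IsHermitian, conjTranspose_smul, (X : su ι).2.1]; simp)
    (fun X Y => ((hab X Y).smul_left _).smul_right _)
  have hd' : ∀ X ∈ H, (U * ((X : su ι) : Matrix ι ι ℂ) * Uᴴ).IsDiag := by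
    intro X hX
    have := (hd ⟨X, hX⟩).smul (-Complex.I)
    simpa [smul_smul] using this
  refine ⟨U, hU, hU', fun X => ⟨hd' X, fun hX => ?_⟩⟩
  -- A matrix that becomes diagonal commutes with `H`, hence normalises it.
  rw [← hH.self_normalizing, LieSubalgebra.mem_normalizer_iff]
  intro Y hY
  suffices ⁅X, Y⁆ = 0 by rw [this]; exact H.zero_mem
  have hc := isDiag_mul_comm hX (hd' Y hY)
  have hc' : (X : Matrix ι ι ℂ) * Y = Y * X := by
    have h2 := congrArg (fun M => Uᴴ * M * U) hc
    simp only [Matrix.mul_assoc, hU, Matrix.mul_one] at h2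
    simpa only [← Matrix.mul_assoc, hU, Matrix.one_mul,
      Matrix.mul_assoc (X : Matrix ι ι ℂ) Uᴴ U, Matrix.mul_assoc (Y : Matrix ι ι ℂ) Uᴴ U,
      Matrix.mul_one] using h2
  exact Subtype.ext (sub_eq_zero.2 hc')

/-! ### Homomorphisms between the algebras `su(N)` and real root vectors -/

section
variable {ι κ : Type} [Fintype ι] [DecidableEq ι] [Fintype κ] [DecidableEq κ]

/-- The homomorphism `X ↦ U X U†` from `su(ι)` to `su(κ)` given by an isometry `U : ℂ^ι → ℂ^κ`. -/
def adSu (U : Matrix κ ι ℂ) (hU : Uᴴ * U = 1) : su ι →ₗ⁅ℝ⁆ su κ where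
  toFun X := ⟨U * (X : Matrix ι ι ℂ) * Uᴴ, by
    obtain ⟨X, hX, hX'⟩ := X
    refine ⟨?_, ?_⟩
    · simp only [conjTranspose_mul, conjTranspose_conjTranspose, hX, Matrix.mul_assoc,
        Matrix.neg_mul, Matrix.mul_neg]
    · rw [trace_mul_comm, ← Matrix.mul_assoc, hU, Matrix.one_mul, hX']⟩
  map_add' X Y := by
    apply Subtype.ext
    change U * (X.1 + Y.1) * Uᴴ = U * X.1 * Uᴴ + U * Y.1 * Uᴴ
    rw [Matrix.mul_add, Matrix.add_mul]
  map_smul' c X := by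
    apply Subtype.ext
    change U * (c • X.1) * Uᴴ = c • (U * X.1 * Uᴴ)
    rw [Matrix.mul_smul, Matrix.smul_mul]
  map_lie' := by
    intro X Y
    apply Subtype.ext
    have h : ∀ A B : Matrix ι ι ℂ, U * (A * B) * Uᴴ = (U * A * Uᴴ) * (U * B * Uᴴ) := by
      intro A B
      simp only [Matrix.mul_assoc]
      rw [← Matrix.mul_assoc Uᴴ U, hU, Matrix.one_mul]
    change U * (X.1 * Y.1 - Y.1 * X.1) * Uᴴ =
      (U * X.1 * Uᴴ) * (U * Y.1 * Uᴴ) - (U * Y.1 * Uᴴ) * (U * X.1 * Uᴴ)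
    rw [Matrix.mul_sub, Matrix.sub_mul, h, h]

@[simp] theorem coe_adSu (U : Matrix κ ι ℂ) (hU : Uᴴ * U = 1) (X : su ι) :
    (adSu U hU X : Matrix κ κ ℂ) = U * (X : Matrix ι ι ℂ) * Uᴴ := rfl

/-- Entrywise complex conjugation as a homomorphism of `su(ι)`. -/
def starSu : su ι →ₗ⁅ℝ⁆ su ι where
  toFun X := ⟨(X : Matrix ι ι ℂ).map (starRingEnd ℂ), by
    obtain ⟨X, hX, hX'⟩ := X
    refine ⟨?_, ?_⟩
    · ext i j
      have h : star (X j i) = -X i j := congrFun (congrFun hX i) j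
      change star (star (X j i)) = -star (X i j)
      rw [h, star_neg]
    · change ∑ i, starRingEnd ℂ (X i i) = 0
      rw [← map_sum]
      exact (congrArg _ hX').trans (map_zero _)⟩
  map_add' X Y := by
    apply Subtype.ext; ext i j
    exact map_add (starRingEnd ℂ) _ _
  map_smul' c X := by
    apply Subtype.ext; ext i j
    change starRingEnd ℂ (c • (X : Matrix ι ι ℂ) i j) = c • starRingEnd ℂ ((X : Matrix ι ι ℂ) i j)
    simp [Complex.real_smul]
  map_lie' := by
    intro X Y
    apply Subtype.ext
    change ((X : Matrix ι ι ℂ) * Y - Y * X).map (starRingEnd ℂ) =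
      (X : Matrix ι ι ℂ).map (starRingEnd ℂ) * (Y : Matrix ι ι ℂ).map (starRingEnd ℂ) -
      (Y : Matrix ι ι ℂ).map (starRingEnd ℂ) * (X : Matrix ι ι ℂ).map (starRingEnd ℂ)
    rw [Matrix.map_sub _ (map_sub _), Matrix.map_mul, Matrix.map_mul]

@[simp] theorem starSu_apply (X : su ι) (i j : ι) :
    (starSu X : Matrix ι ι ℂ) i j = starRingEnd ℂ ((X : Matrix ι ι ℂ) i j) := rfl

theorem su_apply_swap (X : su ι) (i j : ι) :
    (X : Matrix ι ι ℂ) j i = -starRingEnd ℂ ((X : Matrix ι ι ℂ) i j) := by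
  have h : star (X.1 i j) = -X.1 j i := congrFun (congrFun X.2.1 j) i
  exact neg_eq_iff_eq_neg.1 h.symm

/-- Diagonal matrices in `su(N)` are imaginary. -/
theorem starSu_of_isDiag (X : su ι) (hX : (X : Matrix ι ι ℂ).IsDiag) : starSu X = -X := by
  apply Subtype.ext; ext i j
  change _ = -(X : Matrix ι ι ℂ) i j
  rw [starSu_apply]
  by_cases h : i = j
  · subst h
    conv_rhs => rw [su_apply_swap X i i, neg_neg]
  · rw [hX h]; simp

/-- The diagonal matrix with the entries `i (x k - x̄)` for real `x`, where `x̄` is the mean of `x`,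
which makes the trace zero. -/
noncomputable def diagSu (x : ι → ℝ) : su ι :=
  ⟨diagonal fun i => Complex.I * ((x i - (∑ j, x j) / Fintype.card ι : ℝ) : ℂ), by
    refine ⟨?_, ?_⟩
    · rw [diagonal_conjTranspose, diagonal_neg]
      congr 1; ext i
      simp
    · rw [trace_diagonal, ← Finset.mul_sum, ← Complex.ofReal_sum, Finset.sum_sub_distrib]
      rcases isEmpty_or_nonempty ι with h | h
      · simp
      · have : (Fintype.card ι : ℝ) ≠ 0 := by simp
        simp only [Finset.sum_const, Finset.card_univ, nsmul_eq_mul]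
        rw [mul_div_cancel₀ _ this]
        simp⟩

theorem isDiag_diagSu (x : ι → ℝ) : (diagSu x : Matrix ι ι ℂ).IsDiag := isDiag_diagonal _

theorem isDiag_mul_apply {A : Matrix ι ι ℂ} (hA : A.IsDiag) (B : Matrix ι ι ℂ) (i j : ι) :
    (A * B) i j = A i i * B i j := by
  conv_lhs => rw [← hA.diagonal_diag]
  rw [diagonal_mul]; rfl

theorem mul_isDiag_apply {A : Matrix ι ι ℂ} (hA : A.IsDiag) (B : Matrix ι ι ℂ) (i j : ι) :
    (B * A) i j = B i j * A j j := by
  conv_lhs => rw [← hA.diagonal_diag]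
  rw [mul_diagonal]; rfl

theorem isDiag_lie_apply {H : su ι} (hH : (H : Matrix ι ι ℂ).IsDiag) (X : su ι) (i j : ι) :
    (⁅H, X⁆ : su ι).1 i j =
      ((H : Matrix ι ι ℂ) i i - (H : Matrix ι ι ℂ) j j) * (X : Matrix ι ι ℂ) i j := by
  change (H.1 * X.1 - X.1 * H.1) i j = _
  rw [Matrix.sub_apply, isDiag_mul_apply hH, mul_isDiag_apply hH]
  ring

theorem diagSu_lie_apply (x : ι → ℝ) (X : su ι) (i j : ι) :
    (⁅diagSu x, X⁆ : su ι).1 i j = Complex.I * (x i - x j) * (X : Matrix ι ι ℂ) i j := by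
  rw [isDiag_lie_apply (isDiag_diagSu x)]
  simp only [diagSu, diagonal_apply_eq]
  push_cast
  ring

/-- The real root vectors `z E_ij - z̄ E_ji` of `su(N)`. -/
def rootSu (i j : ι) (hij : i ≠ j) (z : ℂ) : su ι :=
  ⟨single i j z - single j i (starRingEnd ℂ z), by
    refine ⟨?_, ?_⟩
    · rw [conjTranspose_sub, conjTranspose_single, conjTranspose_single]
      simp
    · rw [trace_sub, trace_single_eq_of_ne _ _ _ hij, trace_single_eq_of_ne _ _ _ hij.symm,
        sub_zero]⟩

theorem coe_rootSu (i j : ι) (hij : i ≠ j) (z : ℂ) :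
    (rootSu i j hij z : Matrix ι ι ℂ) = single i j z - single j i (starRingEnd ℂ z) := rfl

theorem rootSu_apply_self (i j : ι) (hij : i ≠ j) (z : ℂ) :
    (rootSu i j hij z : Matrix ι ι ℂ) i j = z := by
  rw [coe_rootSu, Matrix.sub_apply, single_apply_same, single_apply, if_neg (by grind), sub_zero]

theorem rootSu_apply_of_ne (i j : ι) (hij : i ≠ j) (z : ℂ) (k l : ι)
    (h : ¬ (k = i ∧ l = j)) (h' : ¬ (k = j ∧ l = i)) :
    (rootSu i j hij z : Matrix ι ι ℂ) k l = 0 := by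
  rw [coe_rootSu, Matrix.sub_apply, single_apply, single_apply, if_neg (by grind),
    if_neg (by grind), sub_zero]

theorem eq_rootSu (i j : ι) (hij : i ≠ j) (X : su ι)
    (h : ∀ k l, ¬ (k = i ∧ l = j) → ¬ (k = j ∧ l = i) → (X : Matrix ι ι ℂ) k l = 0) :
    X = rootSu i j hij ((X : Matrix ι ι ℂ) i j) := by
  apply Subtype.ext; ext k l
  by_cases h1 : k = i ∧ l = j
  · rw [h1.1, h1.2, rootSu_apply_self]
  by_cases h2 : k = j ∧ l = i
  · rw [h2.1, h2.2, su_apply_swap X i j, su_apply_swap _ i j, rootSu_apply_self]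
  rw [h k l h1 h2, rootSu_apply_of_ne _ _ _ _ _ _ h1 h2]

theorem rootSu_add (i j : ι) (hij : i ≠ j) (z w : ℂ) :
    rootSu i j hij (z + w) = rootSu i j hij z + rootSu i j hij w := by
  apply Subtype.ext
  change _ = (rootSu i j hij z : Matrix ι ι ℂ) + rootSu i j hij w
  simp only [coe_rootSu, map_add, single_add]
  abel

theorem rootSu_real_smul (i j : ι) (hij : i ≠ j) (c : ℝ) (z : ℂ) :
    rootSu i j hij (c * z) = c • rootSu i j hij z := by
  apply Subtype.ext
  change _ = c • (rootSu i j hij z : Matrix ι ι ℂ)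
  simp only [coe_rootSu, smul_sub, smul_single, map_mul, Complex.conj_ofReal, Complex.real_smul]

theorem diagSu_left_lie_rootSu (i j : ι) (hij : i ≠ j) (z : ℂ) :
    ⁅diagSu (Pi.single i 1), rootSu i j hij z⁆ = rootSu i j hij (Complex.I * z) := by
  rw [eq_rootSu i j hij ⁅_, _⁆ (fun k l h h' => by
    rw [diagSu_lie_apply, rootSu_apply_of_ne _ _ _ _ _ _ h h', mul_zero])]
  rw [diagSu_lie_apply, rootSu_apply_self]
  simp [hij.symm]

theorem diagSu_right_lie_rootSu (i j : ι) (hij : i ≠ j) (z : ℂ) :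
    ⁅diagSu (Pi.single j 1), rootSu i j hij z⁆ = rootSu i j hij (-Complex.I * z) := by
  rw [eq_rootSu i j hij ⁅_, _⁆ (fun k l h h' => by
    rw [diagSu_lie_apply, rootSu_apply_of_ne _ _ _ _ _ _ h h', mul_zero])]
  rw [diagSu_lie_apply, rootSu_apply_self]
  simp [hij]

theorem rootSu_lie_rootSu (i j k : ι) (hij : i ≠ j) (hjk : j ≠ k) (hik : i ≠ k) (z w : ℂ) :
    ⁅rootSu i j hij z, rootSu j k hjk w⁆ = rootSu i k hik (z * w) := by
  apply Subtype.ext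
  change (rootSu i j hij z : Matrix ι ι ℂ) * rootSu j k hjk w -
    (rootSu j k hjk w : Matrix ι ι ℂ) * rootSu i j hij z = _
  simp only [coe_rootSu, sub_mul, mul_sub, single_mul_single_same,
    single_mul_single_of_ne _ _ _ _ hij, single_mul_single_of_ne _ _ _ _ hij.symm,
    single_mul_single_of_ne _ _ _ _ hjk, single_mul_single_of_ne _ _ _ _ hjk.symm,
    single_mul_single_of_ne _ _ _ _ hik, single_mul_single_of_ne _ _ _ _ hik.symm, map_mul]
  simp [mul_comm]

theorem rootSu_lie_rootSu_self (i j : ι) (hij : i ≠ j) (z w : ℂ) :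
    ((⁅rootSu i j hij z, rootSu i j hij w⁆ : su ι) : Matrix ι ι ℂ).IsDiag ∧
    (⁅rootSu i j hij z, rootSu i j hij w⁆ : su ι).1 i i =
      w * starRingEnd ℂ z - z * starRingEnd ℂ w := by
  have hs : ∀ (k : ι) (a b : ℂ), single k k (a - b) = single k k a - single k k b :=
    fun k => map_sub (singleAddMonoidHom k k)
  have h : ((⁅rootSu i j hij z, rootSu i j hij w⁆ : su ι) : Matrix ι ι ℂ) =
      single i i (w * starRingEnd ℂ z - z * starRingEnd ℂ w) +
      single j j (z * starRingEnd ℂ w - w * starRingEnd ℂ z) := by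
    change (rootSu i j hij z : Matrix ι ι ℂ) * rootSu i j hij w -
      (rootSu i j hij w : Matrix ι ι ℂ) * rootSu i j hij z = _
    simp only [coe_rootSu, sub_mul, mul_sub, single_mul_single_same,
      single_mul_single_of_ne _ _ _ _ hij, single_mul_single_of_ne _ _ _ _ hij.symm]
    rw [mul_comm (starRingEnd ℂ z), mul_comm (starRingEnd ℂ w)]
    rw [hs, hs]
    abel
  constructor
  · rw [h]
    intro k l hkl
    rw [Matrix.add_apply, single_apply, single_apply, if_neg (by grind), if_neg (by grind),
      add_zero]
  · rw [h, Matrix.add_apply, single_apply_same, single_apply, if_neg (by grind), add_zero]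

/-- A homomorphism of `su(N)` which fixes the diagonal matrices maps each real root space to itself,
where it acts as a rotation. -/
theorem exists_map_rootSu (φ : su ι →ₗ⁅ℝ⁆ su ι)
    (hφ : ∀ X : su ι, (X : Matrix ι ι ℂ).IsDiag → φ X = X) (i j : ι) (hij : i ≠ j) :
    ∃ u : ℂ, u * starRingEnd ℂ u = 1 ∧
      ∀ z, φ (rootSu i j hij z) = rootSu i j hij (u * z) := by
  have hd : ∀ x X, φ ⁅diagSu x, X⁆ = ⁅diagSu x, φ X⁆ := fun x X => by
    rw [LieHom.map_lie, hφ _ (isDiag_diagSu x)]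
  have hneg : ∀ z, rootSu i j hij (-z) = -rootSu i j hij z := fun z => by
    have := rootSu_real_smul i j hij (-1) z
    simpa using this
  have hII : ∀ z, Complex.I * (Complex.I * z) = -z := fun z => by
    rw [← mul_assoc, Complex.I_mul_I, neg_one_mul]
  -- The squares of `ad` of the diagonal matrices at `i` and at `j` act by `-1` on the root space.
  have hsupp : ∀ (x : ι → ℝ) z, ⁅diagSu x, ⁅diagSu x, rootSu i j hij z⁆⁆ = -rootSu i j hij z →
      ∀ k l, (φ (rootSu i j hij z)).1 k l ≠ 0 → (x k - x l) ^ 2 = 1 := by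
    intro x z h k l hkl
    have h1 := congrArg φ h
    rw [hd, hd, map_neg] at h1
    have h2 := congrFun (congrFun (congrArg Subtype.val h1) k) l
    rw [diagSu_lie_apply, diagSu_lie_apply] at h2
    change _ = -(φ (rootSu i j hij z)).1 k l at h2
    have h3 : (((x k - x l) ^ 2 : ℝ) : ℂ) = 1 := by
      apply mul_right_cancel₀ hkl
      rw [one_mul]
      apply neg_injective
      rw [← h2]
      push_cast
      linear_combination -((x k : ℂ) - x l) ^ 2 * (φ (rootSu i j hij z)).1 k l * Complex.I_mul_I
    exact_mod_cast h3
  have hroot : ∀ z, φ (rootSu i j hij z) =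
      rootSu i j hij ((φ (rootSu i j hij z)).1 i j) := by
    intro z
    apply eq_rootSu
    intro k l h h'
    by_contra hne
    have h1 := hsupp (Pi.single i 1) z
      (by rw [diagSu_left_lie_rootSu, diagSu_left_lie_rootSu, hII, hneg]) k l hne
    have h2 := hsupp (Pi.single j 1) z
      (by rw [diagSu_right_lie_rootSu, diagSu_right_lie_rootSu, neg_mul, neg_mul, mul_neg, neg_neg,
            hII, hneg]) k l hne
    simp only [Pi.single_apply] at h1 h2
    by_cases a : k = i <;> by_cases b : l = i <;> by_cases c : k = j <;> by_cases d : l = j <;>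
      simp_all
  set u := (φ (rootSu i j hij 1)).1 i j with hu
  have hI : φ (rootSu i j hij Complex.I) = rootSu i j hij (u * Complex.I) := by
    have : rootSu i j hij Complex.I = ⁅diagSu (Pi.single i 1), rootSu i j hij 1⁆ := by
      rw [diagSu_left_lie_rootSu, mul_one]
    rw [this, hd, hroot 1, diagSu_left_lie_rootSu, ← hu, mul_comm]
  have hall : ∀ z, φ (rootSu i j hij z) = rootSu i j hij (u * z) := by
    intro z
    have hz : z = (z.re : ℂ) * 1 + (z.im : ℂ) * Complex.I := by simp
    have hz' : u * z = (z.re : ℂ) * u + (z.im : ℂ) * (u * Complex.I) := by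
      conv_lhs => rw [hz]
      ring
    rw [hz', rootSu_add, rootSu_real_smul, rootSu_real_smul, ← hI]
    conv_lhs => rw [hz]
    rw [rootSu_add, rootSu_real_smul, rootSu_real_smul, map_add, map_smul, map_smul, hroot 1]
  refine ⟨u, ?_, hall⟩
  obtain ⟨h1, h2⟩ := rootSu_lie_rootSu_self i j hij 1 Complex.I
  have h3 := hφ _ h1
  rw [LieHom.map_lie, hall, hall] at h3
  have h4 := congrFun (congrFun (congrArg Subtype.val h3) i) i
  rw [(rootSu_lie_rootSu_self i j hij _ _).2, h2] at h4
  simp only [mul_one, map_mul, map_one, Complex.conj_I, one_mul] at h4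
  have h5 : 2 * Complex.I * (u * starRingEnd ℂ u) = 2 * Complex.I * 1 := by
    linear_combination h4
  exact mul_left_cancel₀ (by simp) h5

/-- Every element of `su(N)` is the sum of a diagonal one and of real root vectors; so a
homomorphism is determined by its values on these. -/
theorem lieHom_ext_rootSu {φ ψ : su ι →ₗ⁅ℝ⁆ su κ}
    (hd : ∀ X : su ι, (X : Matrix ι ι ℂ).IsDiag → φ X = ψ X)
    (hr : ∀ i j hij z, φ (rootSu i j hij z) = ψ (rootSu i j hij z)) (X : su ι) : φ X = ψ X := by
  classical
  let R : ι → ι → su ι := fun i j =>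
    if hij : i = j then 0 else rootSu i j hij ((X : Matrix ι ι ℂ) i j)
  have hR : ∀ i j, φ (R i j) = ψ (R i j) := by
    intro i j
    by_cases h : i = j
    · simp [R, h]
    · simp only [R, h, dite_false]; exact hr _ _ _ _
  -- Each unordered pair of indices occurs twice in the sum, with the same root vector.
  let S : su ι := (1 / 2 : ℝ) • ∑ i, ∑ j, R i j
  have hS : φ S = ψ S := by
    simp only [S, map_smul, map_sum, hR]
  have hD : ((X - S : su ι) : Matrix ι ι ℂ).IsDiag := by
    intro k l hkl
    have hcoe : (S : Matrix ι ι ℂ) k l = (1 / 2 : ℝ) • ∑ i, ∑ j, (R i j : Matrix ι ι ℂ) k l := by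
      let ev : su ι →ₗ[ℝ] ℂ :=
        { toFun := fun Y => (Y : Matrix ι ι ℂ) k l
          map_add' := fun _ _ => rfl
          map_smul' := fun _ _ => rfl }
      change ev S = (1 / 2 : ℝ) • ∑ i, ∑ j, ev (R i j)
      simp only [S, map_smul, map_sum]
    have hent : ∀ i j, (R i j : Matrix ι ι ℂ) k l =
        (if i = k then (if j = l then (X : Matrix ι ι ℂ) k l else 0) else 0) +
        (if i = l then (if j = k then (X : Matrix ι ι ℂ) k l else 0) else 0) := by
      intro i j
      by_cases hij : i = j
      · have h0 : (R i j : Matrix ι ι ℂ) k l = 0 := by simp [R, hij]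
        rw [h0]
        split_ifs <;> simp_all
      have hRij : R i j = rootSu i j hij ((X : Matrix ι ι ℂ) i j) := by simp [R, hij]
      rw [hRij]
      by_cases h1 : k = i ∧ l = j
      · obtain ⟨rfl, rfl⟩ := h1
        rw [rootSu_apply_self]
        simp [hkl]
      by_cases h2 : k = j ∧ l = i
      · obtain ⟨rfl, rfl⟩ := h2
        rw [su_apply_swap _ l k, rootSu_apply_self, ← su_apply_swap]
        simp [hkl.symm]
      rw [rootSu_apply_of_ne _ _ _ _ _ _ h1 h2]
      split_ifs <;> simp_all
    change (X : Matrix ι ι ℂ) k l - (S : Matrix ι ι ℂ) k l = 0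
    rw [hcoe]
    simp only [hent, Finset.sum_add_distrib, Finset.sum_ite_irrel, Finset.sum_const_zero,
      Finset.sum_ite_eq', Finset.mem_univ, if_true]
    rw [Complex.real_smul]
    push_cast
    ring
  have := hd _ hD
  rw [map_sub, map_sub, hS] at this
  exact sub_left_injective this

end

/-! ### Homomorphisms that permute the diagonal matrices -/

section
variable {ι κ : Type} [Fintype ι] [DecidableEq ι] [Fintype κ] [DecidableEq κ]

theorem unimodular_of_mul_self {z w : ℂ} (hw : w * w = z) (hz : z * starRingEnd ℂ z = 1) :
    w * starRingEnd ℂ w = 1 := by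
  rw [Complex.mul_conj, Complex.normSq_eq_norm_sq] at *
  rw [← hw, norm_mul] at hz
  have h : ((‖w‖ ^ 2) ^ 2 : ℝ) = 1 := by
    have : ((‖w‖ * ‖w‖) ^ 2 : ℝ) = 1 := by exact_mod_cast hz
    rw [← this]; ring
  have h' : (‖w‖ ^ 2 : ℝ) = 1 :=
 (pow_eq_one_iff_of_nonneg (sq_nonneg _) two_ne_zero).1 h
  exact_mod_cast h'

/-- The monomial matrix with the entry `d i` in row `i` and column `σ i`. -/
def monomialMatrix {μ : Type} (d : μ → ℂ) (σ : μ ≃ ι) : Matrix μ ι ℂ :=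
  Matrix.of fun i j => if j = σ i then d i else 0

theorem monomialMatrix_mul_apply {μ α : Type} (d : μ → ℂ) (σ : μ ≃ ι) (X : Matrix ι α ℂ) (i : μ)
    (j : α) : (monomialMatrix d σ * X) i j = d i * X (σ i) j := by
  simp [Matrix.mul_apply, monomialMatrix]

theorem mul_monomialMatrix_conjTranspose_apply {μ α : Type} (d : μ → ℂ) (σ : μ ≃ ι)
    (X : Matrix α ι ℂ) (i : α) (j : μ) :
    (X * (monomialMatrix d σ)ᴴ) i j = X i (σ j) * starRingEnd ℂ (d j) := by
  rw [Matrix.mul_apply, Finset.sum_eq_single (σ j)]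
  · simp [monomialMatrix, conjTranspose_apply]
  · intro b _ hb
    simp [monomialMatrix, conjTranspose_apply, hb]
  · simp

theorem monomialMatrix_mul_conjTranspose {μ : Type} [DecidableEq μ] (d : μ → ℂ)
    (hd : ∀ i, d i * starRingEnd ℂ (d i) = 1) (σ : μ ≃ ι) :
    monomialMatrix d σ * (monomialMatrix d σ)ᴴ = 1 := by
  ext i j
  rw [mul_monomialMatrix_conjTranspose_apply]
  by_cases h : i = j
  · subst h; simp [monomialMatrix, hd]
  · simp [monomialMatrix, h, Ne.symm h]

theorem monomialMatrix_conjTranspose_mul (d : κ → ℂ) (hd : ∀ i, d i * starRingEnd ℂ (d i) = 1)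
    (σ : κ ≃ ι) : (monomialMatrix d σ)ᴴ * monomialMatrix d σ = 1 :=
  (mul_eq_one_comm_of_equiv σ).1 (monomialMatrix_mul_conjTranspose d hd σ)

/-- Conjugation by a unitary monomial matrix. -/
def adMono (d : κ → ℂ) (hd : ∀ i, d i * starRingEnd ℂ (d i) = 1) (σ : κ ≃ ι) :
    su ι →ₗ⁅ℝ⁆ su κ :=
  adSu (monomialMatrix d σ) (monomialMatrix_conjTranspose_mul d hd σ)

theorem adMono_apply (d : κ → ℂ) (hd : ∀ i, d i * starRingEnd ℂ (d i) = 1) (σ : κ ≃ ι) (X : su ι)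
    (i j : κ) : (adMono d hd σ X).1 i j = d i * X.1 (σ i) (σ j) * starRingEnd ℂ (d j) := by
  change (monomialMatrix d σ * X.1 * (monomialMatrix d σ)ᴴ) i j = _
  rw [mul_monomialMatrix_conjTranspose_apply, monomialMatrix_mul_apply]

/-- The homomorphism of `su(N)` which permutes rows and columns. -/
def permSu (σ : κ ≃ ι) : su ι →ₗ⁅ℝ⁆ su κ := adMono (fun _ => 1) (by simp) σ

theorem permSu_apply (σ : κ ≃ ι) (X : su ι) (i j : κ) :
    (permSu σ X).1 i j = X.1 (σ i) (σ j) := by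
  simp [permSu, adMono_apply]

theorem isDiag_permSu (σ : κ ≃ ι) {X : su ι} (hX : X.1.IsDiag) : (permSu σ X).1.IsDiag := by
  intro i j hij
  rw [permSu_apply]
  exact hX (σ.injective.ne hij)

/-- A homomorphism of `su(N)` which fixes the diagonal matrices is the conjugation by a unitary
diagonal matrix: the rotations `u i j` of the root spaces satisfy `u i k = u i j * u j k`, so that
`u i j = d i / d j`. -/
theorem exists_eq_adMono_refl (φ : su ι →ₗ⁅ℝ⁆ su ι) (hφ : ∀ X : su ι, X.1.IsDiag → φ X = X) :
    ∃ (d : ι → ℂ) (hd : ∀ i, d i * starRingEnd ℂ (d i) = 1),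
      ∀ X, φ X = adMono d hd (Equiv.refl ι) X := by
  rcases isEmpty_or_nonempty ι with h | ⟨⟨o⟩⟩
  · exact ⟨fun _ => 1, by simp, fun X => Subtype.ext (Subsingleton.elim _ _)⟩
  choose u hu hφu using exists_map_rootSu φ hφ
  let d : ι → ℂ := fun i => if h : i = o then 1 else u i o h
  have hd : ∀ i, d i * starRingEnd ℂ (d i) = 1 := by
    intro i
    by_cases h : i = o
    · simp [d, h]
    · simp only [d, h, dite_false, hu]
  have hswap : ∀ i j hij, u i j hij = starRingEnd ℂ (u j i hij.symm) := by
    intro i j hij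
    have h1 : rootSu i j hij 1 = rootSu j i hij.symm (-1) := by
      apply Subtype.ext
      rw [coe_rootSu, coe_rootSu]
      simp only [map_one, map_neg, ← singleAddMonoidHom_apply]
      abel
    have h2 := congrArg φ h1
    rw [hφu, hφu] at h2
    have h3 := congrFun (congrFun (congrArg Subtype.val h2) i) j
    rw [rootSu_apply_self, su_apply_swap _ j i, rootSu_apply_self] at h3
    simpa using h3
  have hcoc : ∀ i j k (hij : i ≠ j) (hjk : j ≠ k) (hik : i ≠ k),
      u i k hik = u i j hij * u j k hjk := by
    intro i j k hij hjk hik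
    have h1 := congrArg φ (rootSu_lie_rootSu i j k hij hjk hik 1 1)
    rw [LieHom.map_lie, hφu, hφu, hφu, rootSu_lie_rootSu i j k hij hjk hik] at h1
    have h3 := congrFun (congrFun (congrArg Subtype.val h1) i) k
    rw [rootSu_apply_self, rootSu_apply_self] at h3
    simpa using h3.symm
  have hud : ∀ i j hij, u i j hij = d i * starRingEnd ℂ (d j) := by
    intro i j hij
    by_cases hi : i = o
    · subst hi
      simp only [d, hij.symm, dite_true, dite_false, one_mul]
      exact hswap _ _ _
    by_cases hj : j = o
    · subst hj
      simp [d, hi]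
    simp only [d, hi, hj, dite_false]
    rw [hcoc i o j hi (Ne.symm hj) hij, hswap o j]
  refine ⟨d, hd, lieHom_ext_rootSu (fun X hX => ?_) (fun i j hij z => ?_)⟩
  · rw [hφ X hX]
    apply Subtype.ext; ext i j
    rw [adMono_apply]
    by_cases h : i = j
    · subst h
      change _ = d i * X.1 i i * _
      linear_combination -X.1 i i * hd i
    · have h0 : X.1 i j = 0 := hX h
      simp [h0]
  · rw [hφu, eq_rootSu i j hij (adMono d hd (Equiv.refl ι) (rootSu i j hij z))
      (fun k l h h' => by rw [adMono_apply, Equiv.refl_apply, Equiv.refl_apply,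
        rootSu_apply_of_ne _ _ _ _ _ _ h h', mul_zero, zero_mul])]
    rw [adMono_apply, Equiv.refl_apply, Equiv.refl_apply, rootSu_apply_self, hud]
    congr 1; ring

/-- A homomorphism of `su(N)` which permutes the diagonal entries of diagonal matrices is the
conjugation by a unitary monomial matrix. -/
theorem exists_eq_adMono (φ : su ι →ₗ⁅ℝ⁆ su ι) (σ : ι ≃ ι)
    (hφ : ∀ X : su ι, X.1.IsDiag → φ X = permSu σ X) :
    ∃ (d : ι → ℂ) (hd : ∀ i, d i * starRingEnd ℂ (d i) = 1), ∀ X, φ X = adMono d hd σ X := by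
  obtain ⟨d, hd, h⟩ := exists_eq_adMono_refl (φ.comp (permSu σ.symm)) (fun X hX => by
    rw [LieHom.comp_apply, hφ _ (isDiag_permSu _ hX)]
    apply Subtype.ext; ext i j
    simp [permSu_apply])
  refine ⟨d, hd, fun X => ?_⟩
  have h1 := h (permSu σ X)
  have h2 : permSu σ.symm (permSu σ X) = X := by
    apply Subtype.ext; ext i j
    simp [permSu_apply]
  rw [LieHom.comp_apply, h2] at h1
  rw [h1]
  apply Subtype.ext; ext i j
  simp [permSu_apply, adMono_apply]

/-- As `exists_eq_adMono`, for a homomorphism which also changes the sign of diagonal matrices: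
complex conjugation reduces it to that case. -/
theorem exists_eq_starSu_adMono (φ : su ι →ₗ⁅ℝ⁆ su ι) (σ : ι ≃ ι)
    (hφ : ∀ X : su ι, X.1.IsDiag → φ X = -permSu σ X) :
    ∃ (d : ι → ℂ) (hd : ∀ i, d i * starRingEnd ℂ (d i) = 1),
      ∀ X, φ X = starSu (adMono d hd σ X) := by
  obtain ⟨d, hd, h⟩ := exists_eq_adMono (starSu.comp φ) σ (fun X hX => by
    rw [LieHom.comp_apply, hφ X hX, map_neg, starSu_of_isDiag _ (isDiag_permSu σ hX), neg_neg])
  refine ⟨d, hd, fun X => ?_⟩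
  rw [← h, LieHom.comp_apply]
  apply Subtype.ext; ext i j
  simp

/-! ### Cartan involutions -/

/-- `θ` is the involution of `su(N)` with the fixed space `t` and the `-1`-eigenspace `𝔭`. -/
structure IsCartanInvolution (t : LieSubalgebra ℝ (su ι)) (𝔭 : Submodule ℝ (su ι))
    (θ : su ι →ₗ⁅ℝ⁆ su ι) : Prop where
  mem_t : ∀ X, X ∈ t ↔ θ X = X
  mem_p : ∀ X, X ∈ 𝔭 ↔ θ X = -X
  involutive : ∀ X, θ (θ X) = X

theorem IsCartanDecomposition.exists_add {t : LieSubalgebra ℝ (su ι)} {𝔭 : Submodule ℝ (su ι)}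
    (h : IsCartanDecomposition t 𝔭) (X : su ι) : ∃ Y ∈ t, ∃ Z ∈ 𝔭, Y + Z = X := by
  have : X ∈ t.toSubmodule ⊔ 𝔭 := by rw [h.isCompl.sup_eq_top]; trivial
  exact Submodule.mem_sup.1 this

theorem IsCartanDecomposition.eq_zero {t : LieSubalgebra ℝ (su ι)} {𝔭 : Submodule ℝ (su ι)}
    (h : IsCartanDecomposition t 𝔭) {X : su ι} (hX : X ∈ t) (hX' : X ∈ 𝔭) : X = 0 := by
  have : X ∈ t.toSubmodule ⊓ 𝔭 := ⟨hX, hX'⟩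
  rwa [h.isCompl.inf_eq_bot, Submodule.mem_bot] at this

theorem IsCartanDecomposition.exists_involution {t : LieSubalgebra ℝ (su ι)}
    {𝔭 : Submodule ℝ (su ι)} (h : IsCartanDecomposition t 𝔭) :
    ∃ θ : su ι →ₗ⁅ℝ⁆ su ι, IsCartanInvolution t 𝔭 θ := by
  let f := LinearMap.ofIsCompl h.isCompl t.toSubmodule.subtype (-𝔭.subtype)
  have ht : ∀ X ∈ t, f X = X := fun X hX => LinearMap.ofIsCompl_apply_left h.isCompl ⟨X, hX⟩
  have hp : ∀ X ∈ 𝔭, f X = -X := fun X hX => LinearMap.ofIsCompl_apply_right h.isCompl ⟨X, hX⟩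
  have two : ∀ X : su ι, X = -X → X = 0 := fun X hX => by
    have h2 : (2 : ℝ) • X = 0 := by rw [two_smul]; nth_rewrite 1 [hX]; exact neg_add_cancel X
    exact (smul_eq_zero.1 h2).resolve_left two_ne_zero
  let θ : su ι →ₗ⁅ℝ⁆ su ι :=
    { f with
      map_lie' := by
        intro X X'
        obtain ⟨Y, hY, Z, hZ, rfl⟩ := h.exists_add X
        obtain ⟨Y', hY', Z', hZ', rfl⟩ := h.exists_add X'
        change f ⁅Y + Z, Y' + Z'⁆ = ⁅f (Y + Z), f (Y' + Z')⁆
        have h1 : ⁅Z, Y'⁆ ∈ 𝔭 := by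
          rw [← lie_skew]; exact 𝔭.neg_mem (h.lie_t_p _ hY' _ hZ)
        rw [map_add, map_add, ht Y hY, hp Z hZ, ht Y' hY', hp Z' hZ']
        simp only [add_lie, lie_add, map_add, neg_lie, lie_neg]
        rw [ht _ (t.lie_mem hY hY'), hp _ (h.lie_t_p _ hY _ hZ'), hp _ h1,
          ht _ (h.lie_p_p _ hZ _ hZ')]
        abel }
  have hθ : ∀ X, θ X = f X := fun _ => rfl
  refine ⟨θ, fun X => ?_, fun X => ?_, fun X => ?_⟩
  · rw [hθ]
    refine ⟨ht X, fun hX => ?_⟩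
    obtain ⟨Y, hY, Z, hZ, rfl⟩ := h.exists_add X
    rw [map_add, ht Y hY, hp Z hZ] at hX
    rw [two Z (add_left_cancel hX).symm, add_zero]
    exact hY
  · rw [hθ]
    refine ⟨hp X, fun hX => ?_⟩
    obtain ⟨Y, hY, Z, hZ, rfl⟩ := h.exists_add X
    rw [map_add, ht Y hY, hp Z hZ, neg_add] at hX
    rw [two Y (add_right_cancel hX), zero_add]
    exact hZ
  · rw [hθ, hθ]
    obtain ⟨Y, hY, Z, hZ, rfl⟩ := h.exists_add X
    rw [map_add, ht Y hY, hp Z hZ, map_add, map_neg, ht Y hY, hp Z hZ, neg_neg]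

open scoped ComplexOrder in
/-- An element of `su(N)` that commutes with a maximal abelian subspace `𝔞` of `𝔭` and is orthogonal
to it lies in `t`: its component in `𝔭` commutes with `𝔞`, hence lies in `𝔞`, and so is orthogonal
to itself. -/
theorem IsCartanDecomposition.mem_of_commute {t : LieSubalgebra ℝ (su ι)}
    {𝔭 : Submodule ℝ (su ι)} (h : IsCartanDecomposition t 𝔭) {𝔞 : Submodule ℝ (su ι)}
    (ha : IsMaximalAbelianIn 𝔞 𝔭) (X : su ι) (hX : ∀ A ∈ 𝔞, ⁅A, X⁆ = 0)
    (htr : ∀ A ∈ 𝔞, (X.1 * A.1).trace = 0) : X ∈ t := by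
  obtain ⟨Y, hY, Z, hZ, rfl⟩ := h.exists_add X
  -- `⁅A, Y⁆ ∈ 𝔭` and `⁅A, Z⁆ ∈ t` have the sum zero, so both vanish.
  have hcomm : ∀ A ∈ 𝔞, ⁅A, Z⁆ = 0 := by
    intro A hA
    have h1 := hX A hA
    rw [lie_add] at h1
    have h2 : ⁅A, Y⁆ ∈ 𝔭 := by
      rw [← lie_skew]; exact 𝔭.neg_mem (h.lie_t_p _ hY _ (ha.1.1 hA))
    have h3 : ⁅A, Z⁆ ∈ t := h.lie_p_p _ (ha.1.1 hA) _ hZ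
    refine h.eq_zero h3 ?_
    rw [eq_neg_of_add_eq_zero_right h1]
    exact 𝔭.neg_mem h2
  have hZa : Z ∈ 𝔞 := by
    refine ha.2 (y := 𝔞 ⊔ Submodule.span ℝ {Z}) ⟨sup_le ha.1.1 ?_, ?_⟩ le_sup_left
      (Submodule.mem_sup_right (Submodule.mem_span_singleton_self Z))
    · rw [Submodule.span_singleton_le_iff_mem]; exact hZ
    · intro V hV W hW
      obtain ⟨A, hA, _, hc, rfl⟩ := Submodule.mem_sup.1 hV
      obtain ⟨B, hB, _, hc', rfl⟩ := Submodule.mem_sup.1 hW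
      obtain ⟨c, rfl⟩ := Submodule.mem_span_singleton.1 hc
      obtain ⟨c', rfl⟩ := Submodule.mem_span_singleton.1 hc'
      have h4 : ⁅Z, B⁆ = 0 := by rw [← lie_skew, hcomm B hB, neg_zero]
      simp only [add_lie, lie_add, lie_smul, smul_lie, ha.1.2 A hA B hB, hcomm A hA, h4, lie_self,
        smul_zero, add_zero]
  have h5 : ((Y.1 + Z.1) * Z.1).trace = 0 := htr Z hZa
  rw [Matrix.add_mul, trace_add, h.trace_mul Y hY Z hZ, zero_add] at h5
  have h6 : Z.1 = 0 := by
    rw [← trace_conjTranspose_mul_self_eq_zero_iff, Z.2.1, Matrix.neg_mul, trace_neg, h5, neg_zero]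
  rw [show Z = 0 from Subtype.ext h6, add_zero]
  exact hY

/-! ### Recognition of the three types -/

theorem adSu_mul {μ : Type} [Fintype μ] [DecidableEq μ] (U : Matrix κ ι ℂ) (hU : Uᴴ * U = 1)
    (V : Matrix μ κ ℂ) (hV : Vᴴ * V = 1) (hVU : (V * U)ᴴ * (V * U) = 1) (X : su ι) :
    adSu (V * U) hVU X = adSu V hV (adSu U hU X) := by
  apply Subtype.ext
  simp only [coe_adSu, conjTranspose_mul, Matrix.mul_assoc]

theorem adSu_adSu_conjTranspose (U : Matrix κ ι ℂ) (hU : Uᴴ * U = 1) (hU' : Uᴴᴴ * Uᴴ = 1)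
    (X : su κ) : adSu U hU (adSu Uᴴ hU' X) = X := by
  apply Subtype.ext
  simp only [coe_adSu]
  rw [conjTranspose_conjTranspose] at *
  rw [Matrix.mul_assoc, Matrix.mul_assoc, Matrix.mul_assoc, hU', Matrix.mul_one, ← Matrix.mul_assoc,
    hU', Matrix.one_mul]

theorem adSu_conjTranspose_adSu (U : Matrix κ ι ℂ) (hU : Uᴴ * U = 1) (hU' : Uᴴᴴ * Uᴴ = 1)
    (X : su ι) : adSu Uᴴ hU' (adSu U hU X) = X := by
  apply Subtype.ext
  simp only [coe_adSu]
  rw [conjTranspose_conjTranspose]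
  rw [Matrix.mul_assoc, Matrix.mul_assoc, Matrix.mul_assoc, hU, Matrix.mul_one, ← Matrix.mul_assoc,
    hU, Matrix.one_mul]

theorem adSu_injective (U : Matrix κ ι ℂ) (hU : Uᴴ * U = 1) (hU' : U * Uᴴ = 1) :
    Function.Injective (adSu U hU) :=
  Function.LeftInverse.injective
    (g := adSu Uᴴ (by rwa [conjTranspose_conjTranspose])) (adSu_conjTranspose_adSu U hU _)

/-- A unitary matrix that intertwines the involution `θ` with `τ` carries the eigenspaces of `θ` to
those of `τ`. -/
theorem IsCartanInvolution.isUnitarilyConjugate {t : LieSubalgebra ℝ (su ι)}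
    {𝔭 : Submodule ℝ (su ι)} {θ : su ι →ₗ⁅ℝ⁆ su ι} (hθ : IsCartanInvolution t 𝔭 θ)
    (U : Matrix κ ι ℂ) (hU : Uᴴ * U = 1) (hU' : U * Uᴴ = 1) (τ : su κ → su κ)
    (hτ : ∀ X, adSu U hU (θ X) = τ (adSu U hU X)) {t' 𝔭' : Set (Matrix κ κ ℂ)}
    (ht' : ∀ Y, Y ∈ t' ↔ ∃ Z : su κ, Z.1 = Y ∧ τ Z = Z)
    (hp' : ∀ Y, Y ∈ 𝔭' ↔ ∃ Z : su κ, Z.1 = Y ∧ τ Z = -Z) :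
    IsUnitarilyConjugate t 𝔭 t' 𝔭' := by
  have hU'' : Uᴴᴴ * Uᴴ = 1 := by rwa [conjTranspose_conjTranspose]
  have hinj := adSu_injective U hU hU'
  refine ⟨U, hU, hU', ?_, ?_⟩
  · ext Y
    rw [ht']
    constructor
    · rintro ⟨X, hX, rfl⟩
      exact ⟨adSu U hU X, rfl, by rw [← hτ, (hθ.mem_t X).1 hX]⟩
    · rintro ⟨Z, rfl, hZ⟩
      refine ⟨adSu Uᴴ hU'' Z, (hθ.mem_t _).2 (hinj ?_),
        congrArg Subtype.val (adSu_adSu_conjTranspose U hU hU'' Z)⟩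
      rw [hτ, adSu_adSu_conjTranspose, hZ]
  · ext Y
    rw [hp']
    constructor
    · rintro ⟨X, hX, rfl⟩
      exact ⟨adSu U hU X, rfl, by rw [← hτ, (hθ.mem_p X).1 hX, map_neg]⟩
    · rintro ⟨Z, rfl, hZ⟩
      refine ⟨adSu Uᴴ hU'' Z, (hθ.mem_p _).2 (hinj ?_),
        congrArg Subtype.val (adSu_adSu_conjTranspose U hU hU'' Z)⟩
      rw [hτ, map_neg, adSu_adSu_conjTranspose, hZ]

end

/-! ### The intrinsic pairs as eigenspaces of involutions -/

section
variable {ι κ : Type} [Fintype ι] [DecidableEq ι] [Fintype κ] [DecidableEq κ]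

theorem mem_su_of_entries {X : Matrix ι ι ℂ} (h : ∀ i j, starRingEnd ℂ (X j i) = -X i j)
    (htr : X.trace = 0) : X ∈ su ι :=
  ⟨by ext i j; exact h i j, htr⟩

theorem trace_eq_zero_of_entries {μ : Type} [Fintype μ] {X : Matrix μ μ ℂ} (h : ∀ i, X i i = 0) :
    X.trace = 0 :=
  Finset.sum_eq_zero fun i _ => h i

theorem trace_fromBlocks_eq {m n : Type} [Fintype m] [Fintype n] (A : Matrix m m ℂ)
    (B : Matrix m n ℂ) (C : Matrix n m ℂ) (D : Matrix n n ℂ) :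
    (fromBlocks A B C D).trace = A.trace + D.trace := by
  simp [trace]

/-- The intrinsic AI pair consists of the eigenspaces of complex conjugation; see also
`mem_intrinsicPI_iff`. -/
theorem mem_intrinsicTI_iff (Y : Matrix ι ι ℂ) :
    Y ∈ intrinsicTI ι ↔ ∃ Z : su ι, Z.1 = Y ∧ starSu Z = Z := by
  constructor
  · rintro ⟨A, hA, rfl⟩
    rw [LieAlgebra.Orthogonal.mem_so] at hA
    have hA' : ∀ i j, A j i = -A i j := fun i j => congrFun (congrFun hA i) j
    refine ⟨⟨A.map Complex.ofReal, mem_su_of_entries (fun i j => ?_)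
      (trace_eq_zero_of_entries fun i => ?_)⟩, rfl, ?_⟩
    · simp [hA' i j]
    · have := hA' i i
      have h0 : A i i = 0 := by linarith
      simp [h0]
    · apply Subtype.ext; ext i j
      simp
  · rintro ⟨Z, rfl, hZ⟩
    have hre : ∀ i j, (((Z.1 i j).re : ℝ) : ℂ) = Z.1 i j := fun i j =>
      Complex.conj_eq_iff_re.1 (congrFun (congrFun (congrArg Subtype.val hZ) i) j)
    refine ⟨Z.1.map Complex.re, ?_, ?_⟩
    · rw [LieAlgebra.Orthogonal.mem_so]
      ext i j
      change (Z.1 j i).re = -(Z.1 i j).re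
      rw [su_apply_swap Z i j]; simp
    · ext i j
      exact (hre i j).symm

theorem mem_intrinsicPI_iff (Y : Matrix ι ι ℂ) :
    Y ∈ intrinsicPI ι ↔ ∃ Z : su ι, Z.1 = Y ∧ starSu Z = -Z := by
  constructor
  · rintro ⟨A, hA, htr, rfl⟩
    have hA' : ∀ i j, A j i = A i j := fun i j => congrFun (congrFun hA i) j
    refine ⟨⟨Complex.I • A.map Complex.ofReal, mem_su_of_entries (fun i j => ?_) ?_⟩, rfl, ?_⟩
    · simp [hA' i j]
    · have h0 : (A.map Complex.ofReal).trace = ((A.trace : ℝ) : ℂ) := by simp [trace]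
      rw [trace_smul, h0, htr]; simp
    · apply Subtype.ext; ext i j
      change starRingEnd ℂ (Complex.I * (A i j : ℂ)) = -(Complex.I * (A i j : ℂ))
      simp
  · rintro ⟨Z, rfl, hZ⟩
    have hre : ∀ i j, (Z.1 i j).re = 0 := fun i j => by
      have h1 : starRingEnd ℂ (Z.1 i j) = -Z.1 i j :=
        congrFun (congrFun (congrArg Subtype.val hZ) i) j
      have h2 := congrArg Complex.re h1
      rw [Complex.conj_re, Complex.neg_re] at h2
      linarith
    refine ⟨Z.1.map Complex.im, ?_, ?_, ?_⟩
    · ext i j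
      change (Z.1 j i).im = (Z.1 i j).im
      rw [su_apply_swap Z i j]; simp
    · have h1 : Z.1.trace.im = (Z.1.map Complex.im).trace := by simp [trace]
      rw [← h1, Z.2.2, Complex.zero_im]
    · ext i j
      change _ = Complex.I * ((Z.1 i j).im : ℂ)
      apply Complex.ext <;> simp [hre]

theorem isTypeAI_of_intertwines {t : LieSubalgebra ℝ (su ι)}
    {𝔭 : Submodule ℝ (su ι)} {θ : su ι →ₗ⁅ℝ⁆ su ι} (hθ : IsCartanInvolution t 𝔭 θ)
    (U : Matrix ι ι ℂ) (hU : Uᴴ * U = 1) (hU' : U * Uᴴ = 1)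
    (h : ∀ X, adSu U hU (θ X) = starSu (adSu U hU X)) : IsTypeAI t 𝔭 :=
  hθ.isUnitarilyConjugate U hU hU' starSu h mem_intrinsicTI_iff mem_intrinsicPI_iff

/-- The involution `X ↦ (J X J†)*` of `su(2n)`, where `J = (0, -1; 1, 0)`. Its eigenspaces are the
intrinsic AII pair. -/
noncomputable def quatSu (n : ℕ) : su (Fin n ⊕ Fin n) →ₗ⁅ℝ⁆ su (Fin n ⊕ Fin n) :=
  starSu.comp (adMono (Sum.elim (fun _ => -1) fun _ => 1) (by rintro (_ | _) <;> simp)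
    (Equiv.sumComm _ _))

theorem quatSu_apply (n : ℕ) (X : su (Fin n ⊕ Fin n)) (i j : Fin n ⊕ Fin n) :
    (quatSu n X).1 i j = Sum.elim (fun _ => -1) (fun _ => 1) i *
      starRingEnd ℂ (X.1 i.swap j.swap) * Sum.elim (fun _ => -1) (fun _ => 1) j := by
  rw [quatSu, LieHom.comp_apply, starSu_apply, adMono_apply]
  rcases i with i | i <;> rcases j with j | j <;> simp

theorem mem_intrinsicTII_iff (n : ℕ) (Y : Matrix (Fin n ⊕ Fin n) (Fin n ⊕ Fin n) ℂ) :
    Y ∈ intrinsicTII n ↔ ∃ Z : su (Fin n ⊕ Fin n), Z.1 = Y ∧ quatSu n Z = Z := by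
  have key : ∀ Z : su (Fin n ⊕ Fin n), Z.1 ∈ LieAlgebra.Symplectic.sp (Fin n) ℂ ↔
      quatSu n Z = Z := by
    intro Z
    obtain ⟨A, B, C, D, hZ⟩ : ∃ A B C D, Z.1 = fromBlocks A B C D :=
      ⟨_, _, _, _, (fromBlocks_toBlocks Z.1).symm⟩
    rw [LieAlgebra.Symplectic.sp, mem_skewAdjointMatricesLieSubalgebra,
      mem_skewAdjointMatricesSubmodule, Matrix.IsSkewAdjoint, Matrix.IsAdjointPair]
    have hl : (Z.1)ᵀ * J (Fin n) ℂ = J (Fin n) ℂ * -Z.1 ↔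
        ∀ i j, ((Z.1)ᵀ * J (Fin n) ℂ) i j = (J (Fin n) ℂ * -Z.1) i j := by
      constructor
      · intro h i j; rw [h]
      · intro h; ext i j; exact h i j
    have hr : quatSu n Z = Z ↔ ∀ i j, (quatSu n Z).1 i j = Z.1 i j := by
      constructor
      · intro h i j; rw [h]
      · intro h; apply Subtype.ext; ext i j; exact h i j
    -- Both conditions are compared entry by entry; `sp` speaks of `Xᵀ`, which is `-X*` on `su(2n)`.
    rw [hl, hr]
    have e1 : ∀ i j, ((Z.1)ᵀ * J (Fin n) ℂ) i j =
        Sum.elim (fun _ => 1) (fun _ => -1) j * Z.1 j.swap i := by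
      intro i j
      rw [hZ, J, fromBlocks_transpose, fromBlocks_multiply]
      rcases i with i | i <;> rcases j with j | j <;> simp
    have e2 : ∀ i j, (J (Fin n) ℂ * -Z.1) i j =
        Sum.elim (fun _ => 1) (fun _ => -1) i * Z.1 i.swap j := by
      intro i j
      rw [hZ, J, fromBlocks_neg, fromBlocks_multiply]
      rcases i with i | i <;> rcases j with j | j <;> simp
    simp only [e1, e2, quatSu_apply]
    have hs := su_apply_swap Z
    constructor
    · intro h i j
      have h1 := h i j.swap
      rw [Sum.swap_swap, hs i j] at h1
      have h2 := congrArg (starRingEnd ℂ) h1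
      rcases i with i | i <;> rcases j with j | j <;> simp at h2 ⊢ <;>
        first
          | linear_combination h2
          | linear_combination -h2
    · intro h i j
      have h1 := h i j.swap
      rw [Sum.swap_swap] at h1
      have h2 := congrArg (starRingEnd ℂ) h1
      rw [hs i j.swap]
      rcases i with i | i <;> rcases j with j | j <;> simp at h2 ⊢ <;>
        first
          | linear_combination h2
          | linear_combination -h2
  constructor
  · rintro ⟨h1, h2⟩
    exact ⟨⟨Y, h1⟩, rfl, (key ⟨Y, h1⟩).1 h2⟩
  · rintro ⟨Z, rfl, hZ⟩
    exact ⟨Z.2, (key Z).2 hZ⟩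

theorem mem_intrinsicPII_iff (n : ℕ) (Y : Matrix (Fin n ⊕ Fin n) (Fin n ⊕ Fin n) ℂ) :
    Y ∈ intrinsicPII n ↔ ∃ Z : su (Fin n ⊕ Fin n), Z.1 = Y ∧ quatSu n Z = -Z := by
  constructor
  · rintro ⟨A, hA, B, hB, rfl⟩
    rw [LieAlgebra.Orthogonal.mem_so] at hB
    have hB' : ∀ i j, B j i = -B i j := fun i j => congrFun (congrFun hB i) j
    have hA' : ∀ i j, A j i = -starRingEnd ℂ (A i j) := su_apply_swap ⟨A, hA⟩
    refine ⟨⟨fromBlocks A B (B.map star) (-(A.map star)), mem_su_of_entries ?_ ?_⟩, rfl, ?_⟩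
    · rintro (i | i) (j | j) <;> simp [hA' i j, hB' i j]
    · have h1 : (A.map star).trace = star A.trace := by simp [trace]
      rw [trace_fromBlocks_eq, trace_neg, h1, hA.2]; simp
    · apply Subtype.ext; ext i j
      rw [quatSu_apply]
      change _ = -(fromBlocks A B (B.map star) (-(A.map star)) i j)
      rcases i with i | i <;> rcases j with j | j <;> simp
  · rintro ⟨Z, rfl, hZ⟩
    have hZ' : ∀ i j, (quatSu n Z).1 i j = -Z.1 i j := fun i j =>
      congrFun (congrFun (congrArg Subtype.val hZ) i) j
    simp only [quatSu_apply] at hZ'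
    have hs := su_apply_swap Z
    have h22 : Z.1.toBlocks₂₂ = -(Z.1.toBlocks₁₁.map star) := by
      ext i j
      have := hZ' (Sum.inr i) (Sum.inr j)
      simp only [Sum.elim_inr, Sum.swap_inr, one_mul, mul_one] at this
      change Z.1 _ _ = -starRingEnd ℂ (Z.1 _ _)
      rw [this, neg_neg]
    have h21 : Z.1.toBlocks₂₁ = Z.1.toBlocks₁₂.map star := by
      ext i j
      have := hZ' (Sum.inr i) (Sum.inl j)
      simp only [Sum.elim_inr, Sum.swap_inr, Sum.elim_inl, Sum.swap_inl, one_mul] at this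
      change Z.1 _ _ = starRingEnd ℂ (Z.1 _ _)
      linear_combination this
    refine ⟨Z.1.toBlocks₁₁, mem_su_of_entries (fun i j => ?_) ?_, Z.1.toBlocks₁₂, ?_, ?_⟩
    · change starRingEnd ℂ (Z.1 _ _) = -Z.1 _ _
      rw [hs (Sum.inl i) (Sum.inl j)]; simp
    · have h1 : Z.1.toBlocks₁₁.trace - star Z.1.toBlocks₁₁.trace = 0 := by
        have h2 := Z.2.2
        rw [← fromBlocks_toBlocks Z.1, trace_fromBlocks_eq, h22, trace_neg] at h2
        rw [sub_eq_add_neg, ← h2]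
        congr 2
        simp [trace]
      have h3 : star Z.1.toBlocks₁₁.trace = -Z.1.toBlocks₁₁.trace := by
        simp only [trace, star_sum, ← Finset.sum_neg_distrib]
        refine Finset.sum_congr rfl fun i _ => ?_
        have := hs (Sum.inl i) (Sum.inl i)
        change starRingEnd ℂ (Z.1 (Sum.inl i) (Sum.inl i)) = -Z.1 (Sum.inl i) (Sum.inl i)
        conv_rhs => rw [this, neg_neg]
      rw [h3, sub_neg_eq_add] at h1
      linear_combination h1 / 2
    · rw [LieAlgebra.Orthogonal.mem_so]
      ext i j
      change Z.1 (Sum.inl j) (Sum.inr i) = -Z.1 (Sum.inl i) (Sum.inr j)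
      have h4 : Z.1 (Sum.inr i) (Sum.inl j) = starRingEnd ℂ (Z.1 (Sum.inl i) (Sum.inr j)) :=
        congrFun (congrFun h21 i) j
      rw [hs (Sum.inr i) (Sum.inl j), h4, Complex.conj_conj]
    · rw [← h21, ← h22, fromBlocks_toBlocks]

/-- The involution `X ↦ S X S` of `su(m + n)`, where `S = diag(1, -1)`. Its eigenspaces are the
intrinsic AIII pair. -/
noncomputable def signSu (m n : ℕ) : su (Fin m ⊕ Fin n) →ₗ⁅ℝ⁆ su (Fin m ⊕ Fin n) :=
  adMono (Sum.elim (fun _ => 1) fun _ => -1) (by rintro (_ | _) <;> simp) (Equiv.refl _)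

theorem mem_intrinsicTIII_iff (m n : ℕ) (Y : Matrix (Fin m ⊕ Fin n) (Fin m ⊕ Fin n) ℂ) :
    Y ∈ intrinsicTIII m n ↔ ∃ Z : su (Fin m ⊕ Fin n), Z.1 = Y ∧ signSu m n Z = Z := by
  constructor
  · rintro ⟨hY, A, D, rfl⟩
    refine ⟨⟨_, hY⟩, rfl, ?_⟩
    apply Subtype.ext; ext i j
    rw [signSu, adMono_apply]
    rcases i with i | i <;> rcases j with j | j <;> simp
  · rintro ⟨Z, rfl, hZ⟩
    have hZ' : ∀ i j, (signSu m n Z).1 i j = Z.1 i j := fun i j => by rw [hZ]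
    simp only [signSu, adMono_apply] at hZ'
    refine ⟨Z.2, Z.1.toBlocks₁₁, Z.1.toBlocks₂₂, ?_⟩
    ext i j
    have := hZ' i j
    rcases i with i | i <;> rcases j with j | j <;>
      simp [toBlocks₁₁, toBlocks₂₂] at this ⊢ <;> linear_combination (-1 / 2) * this

theorem mem_intrinsicPIII_iff (m n : ℕ) (Y : Matrix (Fin m ⊕ Fin n) (Fin m ⊕ Fin n) ℂ) :
    Y ∈ intrinsicPIII m n ↔ ∃ Z : su (Fin m ⊕ Fin n), Z.1 = Y ∧ signSu m n Z = -Z := by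
  constructor
  · rintro ⟨B, rfl⟩
    refine ⟨⟨fromBlocks 0 B (-Bᴴ) 0, mem_su_of_entries ?_ ?_⟩, rfl, ?_⟩
    · rintro (i | i) (j | j) <;> simp
    · simp [trace_fromBlocks_eq]
    · apply Subtype.ext; ext i j
      rw [signSu, adMono_apply]
      change _ = -(fromBlocks 0 B (-Bᴴ) 0 i j)
      rcases i with i | i <;> rcases j with j | j <;> simp
  · rintro ⟨Z, rfl, hZ⟩
    have hZ' : ∀ i j, (signSu m n Z).1 i j = -Z.1 i j := fun i j => by rw [hZ]; rfl
    simp only [signSu, adMono_apply] at hZ'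
    have hs := su_apply_swap Z
    refine ⟨Z.1.toBlocks₁₂, ?_⟩
    ext i j
    have := hZ' i j
    rcases i with i | i <;> rcases j with j | j
    · simp at this ⊢; linear_combination (1 / 2) * this
    · rfl
    · exact hs _ _
    · simp at this ⊢; linear_combination (1 / 2) * this

end

/-! ### Commutation relations of spinors -/

section
variable {p : ℕ}

theorem neg_one_pow_val_add (x y : ZMod 2) :
    (-1 : ℂ) ^ (x + y).val = (-1 : ℂ) ^ x.val * (-1 : ℂ) ^ y.val := by
  rw [ZMod.val_add, ← pow_add]
  exact (neg_one_pow_eq_pow_mod_two _).symm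

theorem neg_one_pow_val_mul_self (x : ZMod 2) : (-1 : ℂ) ^ x.val * (-1 : ℂ) ^ x.val = 1 := by
  rw [← neg_one_pow_val_add, CharTwo.add_self_eq_zero]; simp

theorem bits_add_self (α : Bits p) : α + α = 0 :=
  funext fun i => CharTwo.add_self_eq_zero (α i)

theorem spinor_zero : spinor (0 : Bits p) 0 = 1 := by
  ext β γ
  simp [spinor, one_apply, eq_comm]

theorem spinor_mul (ζ α η β : Bits p) :
    spinor ζ α * spinor η β = (-1 : ℂ) ^ (η ⬝ᵥ α).val • spinor (ζ + η) (α + β) := by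
  ext b c
  rw [Matrix.mul_apply, Finset.sum_eq_single (b + α)]
  · rw [Matrix.smul_apply]
    simp only [spinor, of_apply, if_true, dotProduct_add, add_dotProduct, neg_one_pow_val_add,
      add_assoc, smul_eq_mul]
    split_ifs <;> ring
  · intro d _ hd
    simp [spinor, hd]
  · simp

theorem spinor_commute (ζ α η β : Bits p) :
    spinor ζ α * spinor η β =
      (-1 : ℂ) ^ (η ⬝ᵥ α + ζ ⬝ᵥ β).val • (spinor η β * spinor ζ α) := by
  rw [spinor_mul, spinor_mul, smul_smul, add_comm η ζ, add_comm β α, neg_one_pow_val_add, mul_assoc,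
    neg_one_pow_val_mul_self, mul_one]

theorem spinor_mul_self (ζ α : Bits p) :
    spinor ζ α * spinor ζ α = (-1 : ℂ) ^ (ζ ⬝ᵥ α).val • (1 : Matrix (Bits p) (Bits p) ℂ) := by
  rw [spinor_mul, bits_add_self, bits_add_self, spinor_zero]

theorem spinor_conjTranspose (ζ α : Bits p) :
    (spinor ζ α)ᴴ = (-1 : ℂ) ^ (ζ ⬝ᵥ α).val • spinor ζ α := by
  ext b c
  have h : b = c + α ↔ c = b + α := by
    constructor
    · rintro rfl; rw [add_assoc, bits_add_self, add_zero]
    · rintro rfl; rw [add_assoc, bits_add_self, add_zero]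
  rw [conjTranspose_apply, Matrix.smul_apply]
  by_cases hc : c = b + α
  · have hb := h.2 hc
    simp only [spinor, of_apply]
    rw [if_pos hb, if_pos hc, hc, dotProduct_add, neg_one_pow_val_add, smul_eq_mul, mul_comm]
    simp
  · simp [spinor, hc, mt h.1 hc]

/-- The commutator pairing on labels of spinors is nondegenerate: every `ℤ₂`-linear functional is the
pairing with the label of some spinor. -/
theorem exists_spinor_pairing (f : (Bits p × Bits p) →ₗ[ZMod 2] ZMod 2) :
    ∃ z a : Bits p, ∀ ζ α, z ⬝ᵥ α + ζ ⬝ᵥ a = f (ζ, α) := by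
  classical
  refine ⟨fun i => f (0, Pi.single i 1), fun i => f (Pi.single i 1, 0), fun ζ α => ?_⟩
  have hsingle : ∀ i : Fin p, (fun j => if i = j then (1 : ZMod 2) else 0) = Pi.single i 1 := by
    intro i; ext j; simp [Pi.single_apply, eq_comm]
  have h1 : f (ζ, 0) = ∑ i, ζ i • f (Pi.single i 1, 0) :=
    LinearMap.pi_apply_eq_sum_univ (f.comp (LinearMap.inl _ _ _)) ζ |>.trans (by
      refine Finset.sum_congr rfl fun i _ => ?_
      rw [hsingle i]; rfl)
  have h2 : f (0, α) = ∑ i, α i • f (0, Pi.single i 1) :=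
    LinearMap.pi_apply_eq_sum_univ (f.comp (LinearMap.inr _ _ _)) α |>.trans (by
      refine Finset.sum_congr rfl fun i _ => ?_
      rw [hsingle i]; rfl)
  have h3 : (ζ, α) = (ζ, (0 : Bits p)) + ((0 : Bits p), α) := by simp
  rw [h3, map_add, h1, h2, add_comm]
  simp only [dotProduct, smul_eq_mul, mul_comm]

/-- A proper maximal bi-subalgebra `B` of `C` is the centraliser in `C` of some spinor, which
anticommutes with the rest of `C`. -/
theorem exists_spinor_centralizer {B C : AddSubgroup (Bits p × Bits p)}
    (h : IsProperMaximalBiSubalgebra B C) : ∃ z a : Bits p,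
      (∀ c ∈ B, spinor z a * spinor c.1 c.2 = spinor c.1 c.2 * spinor z a) ∧
      (∀ c ∈ C, c ∉ B → spinor z a * spinor c.1 c.2 = -(spinor c.1 c.2 * spinor z a)) := by
  obtain ⟨g, hgC, hgB⟩ := SetLike.exists_of_lt h.1
  obtain ⟨f, hfg, hf⟩ := Submodule.exists_le_ker_of_notMem
    (p := AddSubgroup.toZModSubmodule 2 B) (v := g) hgB
  obtain ⟨z, a, hza⟩ := exists_spinor_pairing f
  refine ⟨z, a, fun c hc => ?_, fun c hc hcB => ?_⟩
  · have h0 : f c = 0 := hf hc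
    rw [spinor_commute, add_comm, hza, h0]
    simp
  · have h1 : f (c + g) = 0 := hf (h.2 c hc hcB g hgC hgB)
    rw [map_add] at h1
    have h2 : f c = 1 := by
      generalize f c = x at *
      generalize f g = y at *
      revert x y
      decide
    rw [spinor_commute, add_comm, hza, h2]
    simp [ZMod.val_one]

end

section
variable {ι κ : Type} [Fintype ι] [DecidableEq ι] [Fintype κ] [DecidableEq κ]

/-- The points of a set with a fixed-point-free involution `σ` can be listed in two rows so that `σ`
exchanges the rows. -/
theorem exists_equiv_swap {α : Type} [Fintype α] (σ : α ≃ α) (hσ : ∀ i, σ (σ i) = i)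
    (hfix : ∀ i, σ i ≠ i) {n : ℕ} (hn : Fintype.card α = 2 * n) :
    ∃ e : Fin n ⊕ Fin n ≃ α, ∀ x, σ (e x) = e x.swap := by
  classical
  let f := Fintype.equivFin α
  let S := {i : α // f i < f (σ i)}
  let e₀ : S ⊕ S → α := Sum.elim (fun s => s.1) (fun s => σ s.1)
  have hdisj : ∀ s s' : S, s.1 ≠ σ s'.1 := by
    intro s s' h
    have h1 := s.2
    rw [h, hσ] at h1
    exact lt_asymm h1 s'.2
  have hbij : Function.Bijective e₀ := by
    constructor
    · rintro (s | s) (s' | s') h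
      · exact congrArg Sum.inl (Subtype.ext h)
      · exact absurd h (hdisj s s')
      · exact absurd h.symm (hdisj s' s)
      · exact congrArg Sum.inr (Subtype.ext (σ.injective h))
    · intro i
      rcases lt_trichotomy (f i) (f (σ i)) with h | h | h
      · exact ⟨Sum.inl ⟨i, h⟩, rfl⟩
      · exact absurd (f.injective h).symm (hfix i)
      · exact ⟨Sum.inr ⟨σ i, by rwa [hσ]⟩, hσ i⟩
  have hcard : Fintype.card S = n := by
    have := Fintype.card_of_bijective hbij
    rw [Fintype.card_sum] at this
    omega
  let g : Fin n ≃ S := (Fintype.equivFinOfCardEq hcard).symm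
  refine ⟨(Equiv.sumCongr g g).trans (Equiv.ofBijective e₀ hbij), ?_⟩
  rintro (x | x)
  · rfl
  · exact hσ _

theorem mul_conj_mul {μ : Type} [Fintype μ] (U : Matrix μ ι ℂ) (hU : Uᴴ * U = 1)
    (A B : Matrix ι ι ℂ) :
    (U * A * Uᴴ) * (U * B * Uᴴ) = U * (A * B) * Uᴴ := by
  simp only [Matrix.mul_assoc]
  rw [← Matrix.mul_assoc Uᴴ U, hU, Matrix.one_mul]

/-- Conditions on the diagonal form of a matrix pass to complex linear combinations. -/
theorem conj_isDiag_of_mem_span {μ ν : Type} [Fintype ν] (U : Matrix μ ν ℂ) (σ : μ → μ) (ε : ℂ)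
    {s : Set (Matrix ν ν ℂ)}
    (hs : ∀ M ∈ s, (U * M * Uᴴ).IsDiag ∧
      ∀ i, (U * M * Uᴴ) (σ i) (σ i) = ε * (U * M * Uᴴ) i i)
    {M : Matrix ν ν ℂ} (hM : M ∈ Submodule.span ℂ s) : (U * M * Uᴴ).IsDiag ∧
      ∀ i, (U * M * Uᴴ) (σ i) (σ i) = ε * (U * M * Uᴴ) i i := by
  induction hM using Submodule.span_induction with
  | mem M hM => exact hs M hM
  | zero => simp [isDiag_zero]
  | add A B _ _ hA hB =>
    rw [Matrix.mul_add, Matrix.add_mul]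
    refine ⟨hA.1.add hB.1, fun i => ?_⟩
    rw [Matrix.add_apply, Matrix.add_apply, hA.2, hB.2, mul_add]
  | smul c A _ hA =>
    rw [Matrix.mul_smul, Matrix.smul_mul]
    refine ⟨hA.1.smul c, fun i => ?_⟩
    rw [Matrix.smul_apply, Matrix.smul_apply, hA.2, smul_eq_mul, smul_eq_mul]
    ring

theorem eq_zero_of_even_of_odd {μ : Type} {M : Matrix μ μ ℂ} (σ : μ → μ) (hM : M.IsDiag)
    (h : ∀ i, M (σ i) (σ i) = 1 * M i i) (h' : ∀ i, M (σ i) (σ i) = -1 * M i i) : M = 0 := by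
  ext i j
  by_cases hij : i = j
  · subst hij
    have : M i i = -M i i := by linear_combination h' i - h i
    rw [Matrix.zero_apply]
    linear_combination (1 / 2) * this
  · exact hM hij

end

/-! ### The diagonal form of a spinor Cartan subalgebra -/

section
variable {p : ℕ}

/-- A unitary matrix which diagonalises a Cartan subalgebra spanned by the spinors in `C`
diagonalises these spinors. -/
theorem isDiag_conj_spinor {C : AddSubgroup (Bits p × Bits p)}
    {H : LieSubalgebra ℝ (su (Bits p))}
    (hH : H.toSubmodule = spinorSubspace (C : Set (Bits p × Bits p)))
    {U : Matrix (Bits p) (Bits p) ℂ} (hU' : U * Uᴴ = 1)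
    (hdiag : ∀ X : su (Bits p), X ∈ H ↔ (U * X.1 * Uᴴ).IsDiag) {c : Bits p × Bits p}
    (hc : c ∈ C) : (U * spinor c.1 c.2 * Uᴴ).IsDiag := by
  obtain ⟨u, hu, hsk⟩ : ∃ u : ℂ, u ≠ 0 ∧ (u • spinor c.1 c.2)ᴴ = -(u • spinor c.1 c.2) := by
    have h := spinor_conjTranspose c.1 c.2
    rcases neg_one_pow_eq_or ℂ (c.1 ⬝ᵥ c.2).val with h1 | h1 <;> rw [h1] at h
    · exact ⟨Complex.I, Complex.I_ne_zero, by rw [conjTranspose_smul, h]; simp⟩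
    · exact ⟨1, one_ne_zero, by rw [conjTranspose_smul, h]; simp⟩
  obtain ⟨K, hK⟩ : ∃ K, K = u • spinor c.1 c.2 := ⟨_, rfl⟩
  rw [← hK] at hsk
  have hN : (Fintype.card (Bits p) : ℂ) ≠ 0 := by simp
  set m : ℂ := K.trace / Fintype.card (Bits p) with hm
  -- The trace part of `K` is a multiple of the spinor `S^0_0 = 1`, which also belongs to `C`.
  have htr : (K - m • (1 : Matrix (Bits p) (Bits p) ℂ)).trace = 0 := by
    rw [trace_sub, trace_smul, trace_one, hm, smul_eq_mul, div_mul_cancel₀ _ hN, sub_self]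
  have hstar : star m = -m := by
    have : star K.trace = -K.trace := by rw [← trace_conjTranspose, hsk, trace_neg]
    rw [hm, star_div₀, this, star_natCast, neg_div]
  have hsu : K - m • (1 : Matrix (Bits p) (Bits p) ℂ) ∈ su (Bits p) := by
    refine ⟨?_, htr⟩
    rw [conjTranspose_sub, hsk, conjTranspose_smul, conjTranspose_one, hstar]
    simp [sub_eq_add_neg, add_comm]
  have hmem : (⟨_, hsu⟩ : su (Bits p)) ∈ H := by
    change _ ∈ H.toSubmodule
    rw [hH]
    change K - m • (1 : Matrix (Bits p) (Bits p) ℂ) ∈ Submodule.span ℂ _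
    refine Submodule.sub_mem _ (hK ▸ Submodule.smul_mem _ _ (Submodule.subset_span ⟨c, hc, rfl⟩))
      (Submodule.smul_mem _ _ (Submodule.subset_span ⟨0, C.zero_mem, spinor_zero⟩))
  have h1 := (hdiag _).1 hmem
  have h2 : U * spinor c.1 c.2 * Uᴴ =
      u⁻¹ • (U * (K - m • (1 : Matrix (Bits p) (Bits p) ℂ)) * Uᴴ + m • 1) := by
    rw [Matrix.mul_sub, Matrix.sub_mul, Matrix.mul_smul U m, Matrix.mul_one, Matrix.smul_mul, hU',
      sub_add_cancel, hK, Matrix.mul_smul, Matrix.smul_mul, smul_smul, inv_mul_cancel₀ hu, one_smul]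
  rw [h2]
  exact (h1.add (isDiag_one.smul m)).smul _

/-- For a spinor Cartan subalgebra `C` and a proper maximal bi-subalgebra `B` there are a unitary
matrix and a fixed-point-free involution `σ` of the indices such that the span of `B` becomes the
space of `σ`-even diagonal matrices and that of `C - B` the space of `σ`-odd ones. The involution
describes how a spinor commuting with `B` and anticommuting with `C - B` permutes the joint
eigenspaces of `C`. -/
theorem exists_spinor_diagonalization {B C : AddSubgroup (Bits p × Bits p)}
    (hC : IsSpinorCartan C) (hB : IsProperMaximalBiSubalgebra B C) :
    ∃ (U : Matrix (Bits p) (Bits p) ℂ) (hU : Uᴴ * U = 1) (_ : U * Uᴴ = 1) (σ : Bits p ≃ Bits p),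
      (∀ i, σ (σ i) = i) ∧ (∀ i, σ i ≠ i) ∧
      (∀ X, X ∈ spinorSubspace (B : Set (Bits p × Bits p)) ↔ (adSu U hU X).1.IsDiag ∧
        ∀ i, (adSu U hU X).1 (σ i) (σ i) = 1 * (adSu U hU X).1 i i) ∧
      (∀ X, X ∈ spinorSubspace ((C : Set (Bits p × Bits p)) \ B) ↔ (adSu U hU X).1.IsDiag ∧
        ∀ i, (adSu U hU X).1 (σ i) (σ i) = -1 * (adSu U hU X).1 i i) := by
  classical
  obtain ⟨H, hHC, hH⟩ := hC
  obtain ⟨U, hU, hU', hdiag⟩ := exists_unitary_cartan H hHC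
  obtain ⟨z, a, hcomm, hanti⟩ := exists_spinor_centralizer hB
  let D : Bits p × Bits p → Matrix (Bits p) (Bits p) ℂ := fun c => U * spinor c.1 c.2 * Uᴴ
  have hD : ∀ c ∈ C, (D c).IsDiag := fun c hc => isDiag_conj_spinor hH hU' hdiag hc
  have hsq : ∀ c, D c * D c = (1 : Matrix (Bits p) (Bits p) ℂ) ∨
      D c * D c = -(1 : Matrix (Bits p) (Bits p) ℂ) := by
    intro c
    have h : D c * D c = (-1 : ℂ) ^ (c.1 ⬝ᵥ c.2).val • (1 : Matrix (Bits p) (Bits p) ℂ) := by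
      rw [mul_conj_mul U hU, spinor_mul_self, Matrix.mul_smul, Matrix.mul_one, Matrix.smul_mul, hU']
    rcases neg_one_pow_eq_or ℂ (c.1 ⬝ᵥ c.2).val with h1 | h1 <;> rw [h1] at h
    · left; rw [h, one_smul]
    · right; rw [h, neg_one_smul]
  have hsq_ne : ∀ c i, (D c * D c) i i ≠ 0 := by
    intro c i
    rcases hsq c with h | h <;> rw [h] <;> simp
  -- `W` is the spinor that commutes with `B` and anticommutes with `C - B`; a nonzero entry `W i j`
  -- forces the eigenvalues at `i` and `j` to agree on `B` and to be opposite on `C - B`.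
  set W := D (z, a) with hW
  have hrow : ∀ i, ∃ j, W i j ≠ 0 := by
    intro i
    by_contra! h
    exact hsq_ne (z, a) i (by
      rw [Matrix.mul_apply]
      exact Finset.sum_eq_zero fun j _ => by rw [← hW, h j, zero_mul])
  choose s hs using hrow
  have hsB : ∀ c ∈ B, ∀ i, D c (s i) (s i) = 1 * D c i i := by
    intro c hc i
    have h1 : W * D c = D c * W := by
      rw [hW, mul_conj_mul U hU, mul_conj_mul U hU, hcomm c hc]
    have h2 := congrFun (congrFun h1 i) (s i)
    rw [isDiag_mul_apply (hD c (hB.1.le hc)), mul_isDiag_apply (hD c (hB.1.le hc))] at h2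
    exact mul_left_cancel₀ (hs i) (by rw [h2]; ring)
  have hsC : ∀ c ∈ C, c ∉ B → ∀ i, D c (s i) (s i) = -1 * D c i i := by
    intro c hc hcB i
    have h1 : W * D c = -(D c * W) := by
      rw [hW, mul_conj_mul U hU, mul_conj_mul U hU, hanti c hc hcB, Matrix.mul_neg, Matrix.neg_mul]
    have h2 := congrFun (congrFun h1 i) (s i)
    rw [Matrix.neg_apply, isDiag_mul_apply (hD c hc), mul_isDiag_apply (hD c hc)] at h2
    exact mul_left_cancel₀ (hs i) (by rw [h2]; ring)
  -- The spinors of `C` separate the joint eigenlines, as they span all diagonal matrices.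
  have hsep : ∀ i j, (∀ c ∈ C, D c i i = D c j j) → i = j := by
    intro i j h
    by_contra hij
    have hU'' : Uᴴᴴ * Uᴴ = 1 := by rwa [conjTranspose_conjTranspose]
    have hX := adSu_adSu_conjTranspose U hU hU'' (diagSu (Pi.single i 1))
    have hXH : adSu Uᴴ hU'' (diagSu (Pi.single i 1)) ∈ H.toSubmodule := by
      refine (hdiag _).2 ?_
      change (adSu U hU _).1.IsDiag
      rw [hX]
      exact isDiag_diagSu _
    rw [hH] at hXH
    have key : ∀ M ∈ Submodule.span ℂ
        ((fun g : Bits p × Bits p => spinor g.1 g.2) '' (C : Set (Bits p × Bits p))),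
        (U * M * Uᴴ) i i = (U * M * Uᴴ) j j := by
      intro M hM
      induction hM using Submodule.span_induction with
      | mem M hM => obtain ⟨c, hc, rfl⟩ := hM; exact h c hc
      | zero => simp
      | add A B _ _ hA hB => rw [Matrix.mul_add, Matrix.add_mul, Matrix.add_apply, hA, hB]; rfl
      | smul c A _ hA => rw [Matrix.mul_smul, Matrix.smul_mul, Matrix.smul_apply, hA]; rfl
    have h1 : (adSu U hU (adSu Uᴴ hU'' (diagSu (Pi.single i 1)))).1 i i =
        (adSu U hU (adSu Uᴴ hU'' (diagSu (Pi.single i 1)))).1 j j := key _ hXH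
    rw [hX] at h1
    have h2 := diagSu_lie_apply (Pi.single i 1) (rootSu i j hij 1) i j
    rw [isDiag_lie_apply (isDiag_diagSu _), h1, rootSu_apply_self] at h2
    simp [Ne.symm hij] at h2
    exact Complex.I_ne_zero h2.symm
  have hss : ∀ i, s (s i) = i := by
    intro i
    apply hsep
    intro c hc
    by_cases hcB : c ∈ B
    · rw [hsB c hcB, hsB c hcB]; ring
    · rw [hsC c hc hcB, hsC c hc hcB]; ring
  have hfix : ∀ i, s i ≠ i := by
    intro i hi
    obtain ⟨g, hgC, hgB⟩ := SetLike.exists_of_lt hB.1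
    have h1 := hsC g hgC hgB i
    rw [hi] at h1
    have h2 : D g i i = 0 := by linear_combination (1 / 2) * h1
    exact hsq_ne g i (by rw [isDiag_mul_apply (hD g hgC), h2, zero_mul])
  have evenB : ∀ M ∈ Submodule.span ℂ ((fun g : Bits p × Bits p => spinor g.1 g.2) ''
      (B : Set (Bits p × Bits p))), (U * M * Uᴴ).IsDiag ∧
      ∀ i, (U * M * Uᴴ) (s i) (s i) = 1 * (U * M * Uᴴ) i i := fun M hM =>
    conj_isDiag_of_mem_span U s 1
      (by rintro _ ⟨c, hc, rfl⟩; exact ⟨hD c (hB.1.le hc), hsB c hc⟩) hM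
  have oddC : ∀ M ∈ Submodule.span ℂ ((fun g : Bits p × Bits p => spinor g.1 g.2) ''
      ((C : Set (Bits p × Bits p)) \ B)), (U * M * Uᴴ).IsDiag ∧
      ∀ i, (U * M * Uᴴ) (s i) (s i) = -1 * (U * M * Uᴴ) i i := fun M hM =>
    conj_isDiag_of_mem_span U s (-1)
      (by rintro _ ⟨c, hc, rfl⟩; exact ⟨hD c hc.1, hsC c hc.1 hc.2⟩) hM
  -- The span of `C` is the sum of an even and an odd part, so that even (odd) elements lie in the
  -- first (second) summand.
  have hsplit : ∀ X : su (Bits p), (U * X.1 * Uᴴ).IsDiag →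
      ∃ M ∈ Submodule.span ℂ ((fun g : Bits p × Bits p => spinor g.1 g.2) ''
        (B : Set (Bits p × Bits p))),
      ∃ N ∈ Submodule.span ℂ ((fun g : Bits p × Bits p => spinor g.1 g.2) ''
        ((C : Set (Bits p × Bits p)) \ B)), M + N = X.1 := by
    intro X hX
    have h1 : X ∈ H.toSubmodule := (hdiag X).2 hX
    rw [hH] at h1
    have h2 : X.1 ∈ Submodule.span ℂ ((fun g : Bits p × Bits p => spinor g.1 g.2) ''
        (C : Set (Bits p × Bits p))) := h1
    rw [← Set.union_sdiff_cancel (show (B : Set (Bits p × Bits p)) ⊆ C from hB.1.le),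
      Set.image_union, Submodule.span_union] at h2
    exact Submodule.mem_sup.1 h2
  have hzero : ∀ M : Matrix (Bits p) (Bits p) ℂ, U * M * Uᴴ = 0 → M = 0 := by
    intro M hM
    have h1 : Uᴴ * (U * M * Uᴴ) * U = M := by
      rw [Matrix.mul_assoc, Matrix.mul_assoc, Matrix.mul_assoc, hU, Matrix.mul_one,
        ← Matrix.mul_assoc, hU, Matrix.one_mul]
    rw [← h1, hM, Matrix.mul_zero, Matrix.zero_mul]
  refine ⟨U, hU, hU', ⟨s, s, hss, hss⟩, hss, hfix, fun X => ⟨evenB X.1, ?_⟩,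
    fun X => ⟨oddC X.1, ?_⟩⟩
  · rintro ⟨h1, h2⟩
    obtain ⟨M, hM, N, hN, hMN⟩ := hsplit X h1
    have hN0 : N = 0 := by
      refine hzero N (eq_zero_of_even_of_odd s (oddC N hN).1 (fun i => ?_) (oddC N hN).2)
      have h3 : U * N * Uᴴ = U * X.1 * Uᴴ - U * M * Uᴴ := by
        rw [← hMN, Matrix.mul_add, Matrix.add_mul, add_sub_cancel_left]
      have h4 : (U * X.1 * Uᴴ) (s i) (s i) = 1 * (U * X.1 * Uᴴ) i i := h2 i
      rw [h3, Matrix.sub_apply, Matrix.sub_apply, h4, (evenB M hM).2 i]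
      ring
    change X.1 ∈ Submodule.span ℂ _
    rwa [← hMN, hN0, add_zero]
  · rintro ⟨h1, h2⟩
    obtain ⟨M, hM, N, hN, hMN⟩ := hsplit X h1
    have hM0 : M = 0 := by
      refine hzero M (eq_zero_of_even_of_odd s (evenB M hM).1 (evenB M hM).2 (fun i => ?_))
      have h3 : U * M * Uᴴ = U * X.1 * Uᴴ - U * N * Uᴴ := by
        rw [← hMN, Matrix.mul_add, Matrix.add_mul, add_sub_cancel_right]
      have h4 : (U * X.1 * Uᴴ) (s i) (s i) = -1 * (U * X.1 * Uᴴ) i i := h2 i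
      rw [h3, Matrix.sub_apply, Matrix.sub_apply, h4, (oddC N hN).2 i]
      ring
    change X.1 ∈ Submodule.span ℂ _
    rwa [← hMN, hM0, zero_add]

end

/-! ### Normal forms of the involutions -/

section
variable {ι κ : Type} [Fintype ι] [DecidableEq ι] [Fintype κ] [DecidableEq κ]

theorem adSu_surjective (U : Matrix κ ι ℂ) (hU : Uᴴ * U = 1) (hU' : U * Uᴴ = 1) (Y : su κ) :
    ∃ X, adSu U hU X = Y :=
  ⟨adSu Uᴴ (by rwa [conjTranspose_conjTranspose]) Y, adSu_adSu_conjTranspose _ _ _ _⟩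

/-- The transport `φ` of `θ` by the conjugation with a unitary matrix. -/
theorem exists_transport (θ : su ι →ₗ⁅ℝ⁆ su ι) (U : Matrix κ ι ℂ) (hU : Uᴴ * U = 1)
    (hU' : U * Uᴴ = 1) :
    ∃ φ : su κ →ₗ⁅ℝ⁆ su κ, ∀ X, φ (adSu U hU X) = adSu U hU (θ X) :=
  ⟨(adSu U hU).comp (θ.comp (adSu Uᴴ (by rwa [conjTranspose_conjTranspose]))), fun X => by
    rw [LieHom.comp_apply, LieHom.comp_apply, adSu_conjTranspose_adSu]⟩

theorem mul_unitary {α μ ν : Type} [Fintype α] [Fintype ν] [DecidableEq μ] [DecidableEq ν]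
    {V : Matrix μ ν ℂ} {U : Matrix ν α ℂ} (hV : V * Vᴴ = 1) (hU : U * Uᴴ = 1) :
    (V * U) * (V * U)ᴴ = 1 := by
  rw [conjTranspose_mul, Matrix.mul_assoc, ← Matrix.mul_assoc U, hU, Matrix.one_mul, hV]

theorem mul_isometry {α μ ν : Type} [Fintype μ] [Fintype ν] [DecidableEq α] [DecidableEq ν]
    {V : Matrix μ ν ℂ} {U : Matrix ν α ℂ} (hV : Vᴴ * V = 1) (hU : Uᴴ * U = 1) :
    (V * U)ᴴ * (V * U) = 1 := by
  rw [conjTranspose_mul, Matrix.mul_assoc, ← Matrix.mul_assoc Vᴴ, hV, Matrix.one_mul, hU]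

/-- If `𝔭` contains a Cartan subalgebra, made diagonal, the involution is `X ↦ (D X D†)*` with a
unitary diagonal `D`; conjugation by a square root of `D` turns it into complex conjugation. -/
theorem isTypeAI_of_cartan_le {t : LieSubalgebra ℝ (su ι)} {𝔭 : Submodule ℝ (su ι)}
    (h : IsCartanDecomposition t 𝔭) {H : LieSubalgebra ℝ (su ι)} (hH : H.IsCartanSubalgebra)
    (hHp : H.toSubmodule ≤ 𝔭) : IsTypeAI t 𝔭 := by
  obtain ⟨θ, hθ⟩ := h.exists_involution
  obtain ⟨U, hU, hU', hdiag⟩ := exists_unitary_cartan H hH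
  obtain ⟨φ, hφ⟩ := exists_transport θ U hU hU'
  obtain ⟨d, hd, hφd⟩ := exists_eq_starSu_adMono φ (Equiv.refl ι) (fun Y hY => by
    obtain ⟨X, rfl⟩ := adSu_surjective U hU hU' Y
    have hperm : permSu (Equiv.refl ι) (adSu U hU X) = adSu U hU X := by
      apply Subtype.ext; ext i j
      exact permSu_apply _ _ i j
    rw [hφ, (hθ.mem_p X).1 (hHp ((hdiag X).2 hY)), map_neg, hperm])
  choose e he using fun i => IsAlgClosed.exists_eq_mul_self (d i)
  have he' : ∀ i, e i * starRingEnd ℂ (e i) = 1 := fun i => unimodular_of_mul_self (he i).symm (hd i)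
  have hV := monomialMatrix_conjTranspose_mul e he' (Equiv.refl ι)
  have hV' := monomialMatrix_mul_conjTranspose e he' (Equiv.refl ι)
  refine isTypeAI_of_intertwines hθ (monomialMatrix e (Equiv.refl ι) * U) (mul_isometry hV hU)
    (mul_unitary hV' hU') fun X => ?_
  rw [adSu_mul U hU _ hV, adSu_mul U hU _ hV, ← hφ]
  generalize adSu U hU X = Y
  change adMono e he' (Equiv.refl ι) (φ Y) = starSu (adMono e he' (Equiv.refl ι) Y)
  apply Subtype.ext; ext i j
  rw [hφd, adMono_apply, starSu_apply, starSu_apply, adMono_apply, adMono_apply]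
  simp only [Equiv.refl_apply, he, map_mul, Complex.conj_conj]
  linear_combination starRingEnd ℂ (e i) * starRingEnd ℂ (Y.1 i j) * (e j) *
    (e j * starRingEnd ℂ (e j)) * he' i +
    starRingEnd ℂ (e i) * starRingEnd ℂ (Y.1 i j) * (e j) * he' j

/-- A map that multiplies even diagonal matrices by `ε` and odd ones by `-ε` acts on all diagonal
matrices as `ε` times the permutation `σ`. -/
theorem map_diag_of_even_odd (φ : su ι →ₗ⁅ℝ⁆ su ι) (σ : ι ≃ ι) (hσ : ∀ i, σ (σ i) = i) (ε : ℝ)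
    (heven : ∀ Y : su ι, Y.1.IsDiag → (∀ i, Y.1 (σ i) (σ i) = 1 * Y.1 i i) → φ Y = ε • Y)
    (hodd : ∀ Y : su ι, Y.1.IsDiag → (∀ i, Y.1 (σ i) (σ i) = -1 * Y.1 i i) → φ Y = -(ε • Y))
    (Y : su ι) (hY : Y.1.IsDiag) : φ Y = ε • permSu σ Y := by
  have hp := isDiag_permSu σ hY
  have h1 := heven (Y + permSu σ Y) (hY.add hp) (fun i => by
    change Y.1 _ _ + (permSu σ Y).1 _ _ = 1 * (Y.1 _ _ + (permSu σ Y).1 _ _)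
    rw [permSu_apply, permSu_apply, hσ]; ring)
  have h2 := hodd (Y - permSu σ Y) (hY.sub hp) (fun i => by
    change Y.1 _ _ - (permSu σ Y).1 _ _ = -1 * (Y.1 _ _ - (permSu σ Y).1 _ _)
    rw [permSu_apply, permSu_apply, hσ]; ring)
  rw [map_add, smul_add] at h1
  rw [map_sub, smul_sub] at h2
  have h3 : (2 : ℝ) • φ Y = (2 : ℝ) • (ε • permSu σ Y) := by
    rw [two_smul, two_smul]
    calc φ Y + φ Y = (φ Y + φ (permSu σ Y)) + (φ Y - φ (permSu σ Y)) := by abel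
      _ = _ := by rw [h1, h2]; abel
  exact smul_right_injective _ (two_ne_zero (α := ℝ)) h3

/-- Even and odd diagonal matrices are orthogonal in the trace form. -/
theorem trace_mul_eq_zero_of_even_of_odd {A B : Matrix ι ι ℂ} (σ : ι ≃ ι) (hA : A.IsDiag)
    (h : ∀ i, A (σ i) (σ i) = 1 * A i i) (h' : ∀ i, B (σ i) (σ i) = -1 * B i i) :
    (A * B).trace = 0 := by
  have h1 : (A * B).trace = ∑ i, A i i * B i i :=
    Finset.sum_congr rfl fun i _ => isDiag_mul_apply hA B i i
  have h2 : ∑ i, A i i * B i i = -∑ i, A i i * B i i := by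
    conv_lhs => rw [← Equiv.sum_comp σ]
    rw [← Finset.sum_neg_distrib]
    refine Finset.sum_congr rfl fun i _ => ?_
    rw [h, h']; ring
  rw [h1]
  linear_combination (1 / 2) * h2

theorem trace_adSu_mul (U : Matrix κ ι ℂ) (hU : Uᴴ * U = 1) (X Y : su ι) :
    ((adSu U hU X).1 * (adSu U hU Y).1).trace = (X.1 * Y.1).trace := by
  change ((U * X.1 * Uᴴ) * (U * Y.1 * Uᴴ)).trace = _
  rw [mul_conj_mul U hU, trace_mul_comm, ← Matrix.mul_assoc, hU, Matrix.one_mul]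

theorem lie_eq_zero_of_isDiag {X Y : su ι} (hX : X.1.IsDiag) (hY : Y.1.IsDiag) : ⁅X, Y⁆ = 0 :=
  Subtype.ext (sub_eq_zero.2 (isDiag_mul_comm hX hY))

/-- The quaternionic normal form: the involution `X ↦ (V X V†)*`, with `V` monomial and
antisymmetric, is conjugate to `quatSu` by a monomial matrix. -/
theorem exists_intertwine_quatSu {n : ℕ} (e : Fin n ⊕ Fin n ≃ ι) (σ : ι ≃ ι)
    (he : ∀ x, σ (e x) = e x.swap) (d : ι → ℂ) (hd : ∀ i, d i * starRingEnd ℂ (d i) = 1)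
    (hdσ : ∀ i, d (σ i) = -d i) :
    ∃ (v : Fin n ⊕ Fin n → ℂ) (hv : ∀ i, v i * starRingEnd ℂ (v i) = 1),
      ∀ X, adMono v hv e (starSu (adMono d hd σ X)) = quatSu n (adMono v hv e X) := by
  refine ⟨Sum.elim (fun _ => 1) (fun k => d (e (Sum.inl k))), ?_, fun X => ?_⟩
  · rintro (k | k)
    · simp
    · exact hd _
  · have hr : ∀ k, d (e (Sum.inr k)) = -d (e (Sum.inl k)) := fun k => by
      rw [← hdσ, he]; rfl
    apply Subtype.ext; ext x y
    rw [quatSu_apply, adMono_apply, starSu_apply, adMono_apply, adMono_apply, he, he]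
    rcases x with i | i <;> rcases y with j | j <;> have hi := hd (e (Sum.inl i)) <;>
      have hj := hd (e (Sum.inl j)) <;> simp [hr]
    · linear_combination starRingEnd ℂ (d (e (Sum.inl i))) *
        starRingEnd ℂ (X.1 (e (Sum.inr i)) (e (Sum.inl j))) * hj
    · linear_combination starRingEnd ℂ (X.1 (e (Sum.inl i)) (e (Sum.inr j))) * d (e (Sum.inl j)) * hi
    · linear_combination starRingEnd ℂ (X.1 (e (Sum.inl i)) (e (Sum.inl j))) * hi +
        starRingEnd ℂ (X.1 (e (Sum.inl i)) (e (Sum.inl j))) *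
        (d (e (Sum.inl i)) * starRingEnd ℂ (d (e (Sum.inl i)))) * hj

/-- The unitary matrix `(1, 1; 1, -1) / √2`. -/
noncomputable def hadamardMatrix (n : ℕ) : Matrix (Fin n ⊕ Fin n) (Fin n ⊕ Fin n) ℂ :=
  ((Real.sqrt 2 : ℂ)⁻¹) • fromBlocks 1 1 1 (-1)

theorem hadamardMatrix_conjTranspose (n : ℕ) : (hadamardMatrix n)ᴴ = hadamardMatrix n := by
  rw [hadamardMatrix, conjTranspose_smul, fromBlocks_conjTranspose]
  simp

theorem hadamardMatrix_mul_self (n : ℕ) : hadamardMatrix n * hadamardMatrix n = 1 := by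
  have h2 : (Real.sqrt 2 : ℂ)⁻¹ * (Real.sqrt 2 : ℂ)⁻¹ = 1 / 2 := by
    rw [← mul_inv, ← Complex.ofReal_mul, Real.mul_self_sqrt (by norm_num)]; simp
  rw [hadamardMatrix, Matrix.smul_mul, Matrix.mul_smul, smul_smul, h2, fromBlocks_multiply]
  have h3 : (1 : Matrix (Fin n) (Fin n) ℂ) * 1 + 1 * 1 = (2 : ℂ) • 1 := by
    rw [Matrix.one_mul, two_smul]
  have h4 : (1 : Matrix (Fin n) (Fin n) ℂ) * 1 + -1 * -1 = (2 : ℂ) • 1 := by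
    rw [neg_mul_neg, h3]
  rw [h3, h4, Matrix.mul_neg, Matrix.neg_mul, Matrix.one_mul, add_neg_cancel,
    fromBlocks_smul, smul_smul]
  norm_num

/-- The Hadamard matrix conjugates the exchange of the two summands of `ℂ^n ⊕ ℂ^n` to
`diag(1, -1)`. -/
theorem hadamardMatrix_intertwine (n : ℕ) (h : (hadamardMatrix n)ᴴ * hadamardMatrix n = 1)
    (X : su (Fin n ⊕ Fin n)) :
    adSu (hadamardMatrix n) h (permSu (Equiv.sumComm _ _) X) =
      signSu n n (adSu (hadamardMatrix n) h X) := by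
  apply Subtype.ext
  have hP : (monomialMatrix (fun _ => 1) (Equiv.sumComm (Fin n) (Fin n)) :
      Matrix (Fin n ⊕ Fin n) (Fin n ⊕ Fin n) ℂ) = fromBlocks 0 1 1 0 := by
    ext i j
    rcases i with i | i <;> rcases j with j | j <;> simp [monomialMatrix, one_apply, eq_comm]
  have hS : (monomialMatrix (Sum.elim (fun _ => 1) fun _ => -1) (Equiv.refl (Fin n ⊕ Fin n)) :
      Matrix (Fin n ⊕ Fin n) (Fin n ⊕ Fin n) ℂ) = fromBlocks 1 0 0 (-1) := by
    ext i j
    rcases i with i | i <;> rcases j with j | j <;>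
      simp [monomialMatrix, one_apply, eq_comm]
    split_ifs <;> simp
  have hFP : hadamardMatrix n * monomialMatrix (fun _ => 1) (Equiv.sumComm (Fin n) (Fin n)) =
      monomialMatrix (Sum.elim (fun _ => 1) fun _ => -1) (Equiv.refl (Fin n ⊕ Fin n)) *
        hadamardMatrix n := by
    rw [hP, hS, hadamardMatrix, Matrix.smul_mul, Matrix.mul_smul, fromBlocks_multiply,
      fromBlocks_multiply]
    simp
  generalize hPd : monomialMatrix (fun _ => 1) (Equiv.sumComm (Fin n) (Fin n)) = P at *
  generalize hSd : monomialMatrix (Sum.elim (fun _ => 1) fun _ => -1)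
    (Equiv.refl (Fin n ⊕ Fin n)) = S at *
  have e1 : (permSu (Equiv.sumComm (Fin n) (Fin n)) X).1 = P * X.1 * Pᴴ := by rw [← hPd]; rfl
  have e2 : ∀ Y, (signSu n n Y).1 = S * Y.1 * Sᴴ := fun Y => by rw [← hSd]; rfl
  rw [e2, coe_adSu, coe_adSu, e1]
  calc hadamardMatrix n * (P * X.1 * Pᴴ) * (hadamardMatrix n)ᴴ
      = (hadamardMatrix n * P) * X.1 * (hadamardMatrix n * P)ᴴ := by
        rw [conjTranspose_mul]; simp only [Matrix.mul_assoc]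
    _ = _ := by rw [hFP, conjTranspose_mul]; simp only [Matrix.mul_assoc]

/-- The conjugation by a monomial matrix `V` over a fixed-point-free involution, with `V ^ 2` scalar,
is conjugate to `signSu`. -/
theorem exists_intertwine_permSu {n : ℕ} (e : Fin n ⊕ Fin n ≃ ι) (σ : ι ≃ ι)
    (he : ∀ x, σ (e x) = e x.swap) (d : ι → ℂ) (hd : ∀ i, d i * starRingEnd ℂ (d i) = 1)
    (k : ℂ) (hdσ : ∀ i, d i * d (σ i) = k) (hk : k * starRingEnd ℂ k = 1) :
    ∃ (v : Fin n ⊕ Fin n → ℂ) (hv : ∀ i, v i * starRingEnd ℂ (v i) = 1),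
      ∀ X, adMono v hv e (adMono d hd σ X) = permSu (Equiv.sumComm _ _) (adMono v hv e X) := by
  obtain ⟨m, hm⟩ := IsAlgClosed.exists_eq_mul_self k
  have hm1 : m * starRingEnd ℂ m = 1 := unimodular_of_mul_self hm.symm hk
  -- With this choice of `v` the monomial matrix becomes `m` times the exchange of the summands.
  let v : Fin n ⊕ Fin n → ℂ :=
    Sum.elim (fun _ => 1) (fun k => d (e (Sum.inl k)) * starRingEnd ℂ m)
  have hv : ∀ i, v i * starRingEnd ℂ (v i) = 1 := by
    rintro (k | k)
    · simp [v]
    · simp only [v, Sum.elim_inr, map_mul, Complex.conj_conj]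
      linear_combination hd (e (Sum.inl k)) + d (e (Sum.inl k)) *
        starRingEnd ℂ (d (e (Sum.inl k))) * hm1
  have hvd : ∀ x, v x * d (e x) = m * v x.swap := by
    rintro (k | k)
    · simp only [v, Sum.elim_inl, Sum.swap_inl, Sum.elim_inr]
      linear_combination -d (e (Sum.inl k)) * hm1
    · have h1 := hdσ (e (Sum.inl k))
      rw [he, Sum.swap_inl, hm] at h1
      simp only [v, Sum.elim_inl, Sum.swap_inr, Sum.elim_inr]
      linear_combination starRingEnd ℂ m * h1 + m * hm1
  refine ⟨v, hv, fun X => ?_⟩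
  apply Subtype.ext; ext x y
  rw [permSu_apply, adMono_apply, adMono_apply, adMono_apply, he, he]
  have hx := hvd x
  have hy := congrArg (starRingEnd ℂ) (hvd y)
  rw [map_mul, map_mul] at hy
  change _ = v x.swap * X.1 (e x.swap) (e y.swap) * starRingEnd ℂ (v y.swap)
  calc v x * (d (e x) * X.1 (e x.swap) (e y.swap) * starRingEnd ℂ (d (e y))) * starRingEnd ℂ (v y)
      = (v x * d (e x)) * X.1 (e x.swap) (e y.swap) *
          (starRingEnd ℂ (v y) * starRingEnd ℂ (d (e y))) := by ring
    _ = _ := by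
      rw [hx, hy]
      linear_combination v x.swap * X.1 (e x.swap) (e y.swap) * starRingEnd ℂ (v y.swap) * hm1

end

section
variable {p : ℕ}

theorem card_bits (i : Bits p) (σ : Bits p → Bits p) (h : σ i ≠ i) :
    Fintype.card (Bits p) = 2 * 2 ^ (p - 1) := by
  rcases p with _ | q
  · exact absurd (Subsingleton.elim _ _) h
  · simp [Bits, ZMod.card, pow_succ, mul_comm]

/-- If the span of `B` is maximal abelian in `𝔭`, the involution is `X ↦ (V X V†)*` with a monomial
matrix `V`. As the root vectors of the pairs `i, σ i` commute with the span of `B` and are orthogonal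
to it, they lie in `t`, and this makes `V` antisymmetric. -/
theorem isTypeAII_of_maximal {t : LieSubalgebra ℝ (su (Bits p))} {𝔭 : Submodule ℝ (su (Bits p))}
    (h : IsCartanDecomposition t 𝔭) {B C : AddSubgroup (Bits p × Bits p)}
    (hC : IsSpinorCartan C) (hB : IsProperMaximalBiSubalgebra B C)
    (hmax : IsMaximalAbelianIn (spinorSubspace (B : Set (Bits p × Bits p))) 𝔭) :
    IsTypeAII t 𝔭 (2 ^ (p - 1)) := by
  obtain ⟨θ, hθ⟩ := h.exists_involution
  obtain ⟨U, hU, hU', σ, hσ, hfix, hBU, -⟩ := exists_spinor_diagonalization hC hB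
  obtain ⟨φ, hφ⟩ := exists_transport θ U hU hU'
  have hfixed : ∀ Y : su (Bits p), (∀ A : su (Bits p), A.1.IsDiag →
      (∀ i, A.1 (σ i) (σ i) = 1 * A.1 i i) → ⁅A, Y⁆ = 0 ∧ (Y.1 * A.1).trace = 0) → φ Y = Y := by
    intro Y hY
    obtain ⟨X, rfl⟩ := adSu_surjective U hU hU' Y
    rw [hφ, (hθ.mem_t X).1]
    refine h.mem_of_commute hmax X (fun A hA => ?_) (fun A hA => ?_)
    · apply adSu_injective U hU hU'
      rw [LieHom.map_lie, (hY _ ((hBU A).1 hA).1 ((hBU A).1 hA).2).1, map_zero]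
    · rw [← trace_adSu_mul U hU]
      exact (hY _ ((hBU A).1 hA).1 ((hBU A).1 hA).2).2
  have heven : ∀ Y : su (Bits p), Y.1.IsDiag → (∀ i, Y.1 (σ i) (σ i) = 1 * Y.1 i i) →
      φ Y = (-1 : ℝ) • Y := by
    intro Y hY hYσ
    obtain ⟨X, rfl⟩ := adSu_surjective U hU hU' Y
    rw [hφ, (hθ.mem_p X).1 (hmax.1.1 ((hBU X).2 ⟨hY, hYσ⟩)), map_neg, neg_one_smul]
  have hodd : ∀ Y : su (Bits p), Y.1.IsDiag → (∀ i, Y.1 (σ i) (σ i) = -1 * Y.1 i i) →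
      φ Y = -((-1 : ℝ) • Y) := by
    intro Y hY hYσ
    rw [neg_one_smul, neg_neg]
    refine hfixed Y fun A hA hAσ => ⟨lie_eq_zero_of_isDiag hA hY, ?_⟩
    rw [trace_mul_comm]
    exact trace_mul_eq_zero_of_even_of_odd σ hA hAσ hYσ
  obtain ⟨d, hd, hφd⟩ := exists_eq_starSu_adMono φ σ (fun Y hY => by
    rw [map_diag_of_even_odd φ σ hσ (-1) heven hodd Y hY, neg_one_smul])
  have hdσ : ∀ i, d (σ i) = -d i := by
    intro i
    have hi : i ≠ σ i := (hfix i).symm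
    have h1 : φ (rootSu i (σ i) hi 1) = rootSu i (σ i) hi 1 := by
      refine hfixed _ fun A hA hAσ => ⟨?_, ?_⟩
      · apply Subtype.ext; ext k l
        rw [isDiag_lie_apply hA]
        change _ = (0 : ℂ)
        by_cases h1 : k = i ∧ l = σ i
        · rw [h1.1, h1.2, hAσ]; ring
        by_cases h2 : k = σ i ∧ l = i
        · rw [h2.1, h2.2, hAσ]; ring
        rw [rootSu_apply_of_ne _ _ _ _ _ _ h1 h2, mul_zero]
      · refine Finset.sum_eq_zero fun k _ => ?_
        change ((rootSu i (σ i) hi 1).1 * A.1) k k = 0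
        rw [mul_isDiag_apply hA, rootSu_apply_of_ne _ _ _ _ _ _
          (fun h => hi (h.1.symm.trans h.2)) (fun h => hi (h.2.symm.trans h.1)), zero_mul]
    have h2 := congrFun (congrFun (congrArg Subtype.val h1) i) (σ i)
    rw [hφd, starSu_apply, adMono_apply, hσ, su_apply_swap _ i (σ i), rootSu_apply_self] at h2
    simp only [map_mul, map_neg, Complex.conj_conj, map_one] at h2
    linear_combination -d i * h2 - d (σ i) * hd i
  obtain ⟨e, he⟩ := exists_equiv_swap σ hσ hfix (card_bits 0 σ (hfix 0))
  obtain ⟨v, hv, hvX⟩ := exists_intertwine_quatSu e σ he d hd hdσ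
  have hV := monomialMatrix_conjTranspose_mul v hv e
  have hV' := monomialMatrix_mul_conjTranspose v hv e
  refine hθ.isUnitarilyConjugate (monomialMatrix v e * U) (mul_isometry hV hU)
    (mul_unitary hV' hU') (quatSu _) (fun X => ?_) (mem_intrinsicTII_iff _) (mem_intrinsicPII_iff _)
  rw [adSu_mul U hU _ hV, adSu_mul U hU _ hV, ← hφ, hφd]
  exact hvX _

/-- If the span of `C - B` is maximal abelian in `𝔭`, the involution is `X ↦ V X V†` with a monomial
matrix `V` whose square is scalar. -/
theorem isTypeAIII_of_maximal {t : LieSubalgebra ℝ (su (Bits p))} {𝔭 : Submodule ℝ (su (Bits p))}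
    (h : IsCartanDecomposition t 𝔭) {B C : AddSubgroup (Bits p × Bits p)}
    (hC : IsSpinorCartan C) (hB : IsProperMaximalBiSubalgebra B C)
    (hmax : IsMaximalAbelianIn (spinorSubspace ((C : Set (Bits p × Bits p)) \ B)) 𝔭) :
    IsTypeAIII t 𝔭 (2 ^ (p - 1)) (2 ^ (p - 1)) := by
  obtain ⟨θ, hθ⟩ := h.exists_involution
  obtain ⟨U, hU, hU', σ, hσ, hfix, -, hCU⟩ := exists_spinor_diagonalization hC hB
  obtain ⟨φ, hφ⟩ := exists_transport θ U hU hU'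
  have heven : ∀ Y : su (Bits p), Y.1.IsDiag → (∀ i, Y.1 (σ i) (σ i) = 1 * Y.1 i i) →
      φ Y = (1 : ℝ) • Y := by
    intro Y hY hYσ
    obtain ⟨X, rfl⟩ := adSu_surjective U hU hU' Y
    rw [hφ, one_smul, (hθ.mem_t X).1]
    refine h.mem_of_commute hmax X (fun A hA => ?_) (fun A hA => ?_)
    · apply adSu_injective U hU hU'
      rw [LieHom.map_lie, lie_eq_zero_of_isDiag ((hCU A).1 hA).1 hY, map_zero]
    · rw [← trace_adSu_mul U hU]
      exact trace_mul_eq_zero_of_even_of_odd σ hY hYσ ((hCU A).1 hA).2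
  have hodd : ∀ Y : su (Bits p), Y.1.IsDiag → (∀ i, Y.1 (σ i) (σ i) = -1 * Y.1 i i) →
      φ Y = -((1 : ℝ) • Y) := by
    intro Y hY hYσ
    obtain ⟨X, rfl⟩ := adSu_surjective U hU hU' Y
    rw [hφ, (hθ.mem_p X).1 (hmax.1.1 ((hCU X).2 ⟨hY, hYσ⟩)), map_neg, one_smul]
  obtain ⟨d, hd, hφd⟩ := exists_eq_adMono φ σ (fun Y hY => by
    rw [map_diag_of_even_odd φ σ hσ 1 heven hodd Y hY, one_smul])
  have hφφ : ∀ Y, φ (φ Y) = Y := by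
    intro Y
    obtain ⟨X, rfl⟩ := adSu_surjective U hU hU' Y
    rw [hφ, hφ, hθ.involutive]
  -- The square of the monomial matrix is diagonal with the entries `d i * d (σ i)`; it acts trivially
  -- on root vectors, so these entries agree.
  have hk1 : ∀ i, (d i * d (σ i)) * starRingEnd ℂ (d i * d (σ i)) = 1 := by
    intro i
    rw [map_mul]
    linear_combination hd i + d i * starRingEnd ℂ (d i) * hd (σ i)
  have hdσ : ∀ i, d i * d (σ i) = d 0 * d (σ 0) := by
    intro i
    by_cases hi : i = 0
    · rw [hi]
    have h2 := congrFun (congrFun (congrArg Subtype.val (hφφ (rootSu i 0 hi 1))) i) 0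
    rw [hφd, adMono_apply, hφd, adMono_apply, hσ, hσ, rootSu_apply_self] at h2
    have h3 := hk1 0
    rw [map_mul] at h3
    linear_combination d 0 * d (σ 0) * h2 - d i * d (σ i) * h3
  obtain ⟨e, he⟩ := exists_equiv_swap σ hσ hfix (card_bits 0 σ (hfix 0))
  obtain ⟨v, hv, hvX⟩ := exists_intertwine_permSu e σ he d hd _ hdσ (hk1 0)
  have hV := monomialMatrix_conjTranspose_mul v hv e
  have hV' := monomialMatrix_mul_conjTranspose v hv e
  have hF : (hadamardMatrix (2 ^ (p - 1)))ᴴ * hadamardMatrix (2 ^ (p - 1)) = 1 := by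
    rw [hadamardMatrix_conjTranspose, hadamardMatrix_mul_self]
  have hF' : hadamardMatrix (2 ^ (p - 1)) * (hadamardMatrix (2 ^ (p - 1)))ᴴ = 1 := by
    rw [hadamardMatrix_conjTranspose, hadamardMatrix_mul_self]
  refine hθ.isUnitarilyConjugate (hadamardMatrix _ * (monomialMatrix v e * U))
    (mul_isometry hF (mul_isometry hV hU)) (mul_unitary hF' (mul_unitary hV' hU')) (signSu _ _)
    (fun X => ?_) (mem_intrinsicTIII_iff _ _) (mem_intrinsicPIII_iff _ _)
  rw [adSu_mul _ (mul_isometry hV hU) _ hF, adSu_mul _ (mul_isometry hV hU) _ hF,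
    adSu_mul U hU _ hV, adSu_mul U hU _ hV, ← hφ, hφd, ← hadamardMatrix_intertwine]
  exact congrArg _ (hvX _)

end

theorem mainTheorem2 :
    (∀ (ι : Type) [Fintype ι] [DecidableEq ι]
      (t : LieSubalgebra ℝ (su ι)) (𝔭 : Submodule ℝ (su ι)),
      IsCartanDecomposition t 𝔭 →
      (∃ H : LieSubalgebra ℝ (su ι), H.IsCartanSubalgebra ∧ H.toSubmodule ≤ 𝔭) →
      IsTypeAI t 𝔭) ∧
    (∀ (p : ℕ) (t : LieSubalgebra ℝ (su (Bits p))) (𝔭 : Submodule ℝ (su (Bits p))),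
      IsCartanDecomposition t 𝔭 →
      ∀ B C : AddSubgroup (Bits p × Bits p),
      IsSpinorCartan C → IsProperMaximalBiSubalgebra B C →
      (IsMaximalAbelianIn (spinorSubspace (B : Set (Bits p × Bits p))) 𝔭 →
        IsTypeAII t 𝔭 (2 ^ (p - 1))) ∧
      (IsMaximalAbelianIn (spinorSubspace ((C : Set (Bits p × Bits p)) \ B)) 𝔭 →
        IsTypeAIII t 𝔭 (2 ^ (p - 1)) (2 ^ (p - 1)))) := by
  refine ⟨fun ι _ _ t 𝔭 h => ?_, fun p t 𝔭 h B C hC hB =>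
    ⟨isTypeAII_of_maximal h hC hB, isTypeAIII_of_maximal h hC hB⟩⟩
  rintro ⟨H, hH, hHp⟩
  exact isTypeAI_of_cartan_le h hH hHp
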